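/- Let $n\ge 1$ and let $N$ be the number of followers. Let $A=[a_{ij}]\in\mathbb R^{N\times N}$ with $a_{ij}\ge 0$, $a_{ii}=0$ (follower $i$ receives information from follower $j$ iff $a_{ij}>0$), let $b_i\in\{0,1\}$ ($b_i=1$ iff follower $i$ receives information from the leader, node $0$), and assume that the augmented directed graph on $\{0,1,\dots,N\}$ has a directed spanning tree rooted at the leader. Let the leader trajectory $y_0:[0,\infty)\to\mathbb R$ and its derivatives up to order $n$ be bounded and piecewise continuous (those of order $<n$ exist everywhere and are continuous; the $n$-th exists and is continuous off a set with finitely many points in each bounded interval, at which it has finite one-sided limits). Let $\lambda>0$, $c_i>0$, and let $\rho_i:[0,\infty)\to(0,\infty)$ be performance functions: decreasing, with a positive limit at infinity, and with derivatives up to order $n$ bounded and piecewise continuous in the same sense (for instance $\rho_i(t)=(\rho_{i,0}-\rho_{i,\infty})e^{-\iota t}+\rho_{i,\infty}$ with $\rho_{i,0}>\rho_{i,\infty}>0$, $\iota>0$). Consider the $N$ filters $\hat y_i^{(n)}=\nu_i$ with states $\hat y_i,\dots,\hat y_i^{(n-1)}$, and put $$z_i=\sum_{j}a_{ij}(\hat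 y_i-\hat y_j)+b_i(\hat y_i-y_0),\qquad \bar z_i=\Big(\frac{d}{dt}+\lambda\Big)^{n-1}z_i=\sum_{k=0}^{n-1}\binom{n-1}{k}\lambda^k z_i^{(n-1-k)},\qquad \zeta_i=\frac{\bar z_i}{\rho_i},$$ $$O_i=\ln\frac{1+\zeta_i}{1-\zeta_i},\qquad M_i=\frac1{1-\zeta_i^2},\qquad \nu_i=-\frac{c_i}{\rho_i}\,M_iO_i .$$ Then: (1) For all initial states with $|\zeta_i(0)|<1$ for every $i$, the closed-loop system has a solution on $[0,\infty)$, it satisfies $|\bar z_i(t)|<\rho_i(t)$ for all $t\ge0$ and all $i$, and every solution on an interval $[0,T)$ with the same initial state coincides with it there. (2) All signals of the closed loop are semi-globally uniformly ultimately bounded: there is a constant $\mu$ such that for all $\varrho\in(0,1)$ and $R$ there are constants $K$ and $\tau$ such that, for every solution on $[0,\infty)$ with $|\hat y_i^{(k)}(0)|\le R$ ($k<n$) and $|\zeta_i(0)|<1-\varrho$ for all $i$, the signals $\hat y_i^{(k)}$, $\hat y_i^{(k)}-y_0^{(k)}$, $z_i^{(k)}$ ($k<n$), $\bar z_i$, $\zeta_i$,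 $O_i$, $M_i$ and $\nu_i$ are bounded in absolute value by $K$ for all $t\ge0$ and by $\mu$ for all $t\ge\max(\tau,0)$. -/

import Mathlib

open Set Filter Topology

noncomputable section

/-- `f` and its derivatives up to order `n ≥ 1` on `[0, ∞)` are bounded and piecewise continuous.
The derivatives of order `< n` exist everywhere and are continuous; the `n`-th derivative exists
and is continuous off a set `S` with finitely many points in each bounded interval, and has finite
one-sided limits at the points of `S`. -/
structure HasBoundedPiecewiseDerivs (n : ℕ) (f : ℝ → ℝ) : Prop where
  contDiffOn : ContDiffOn ℝ ((n - 1 : ℕ) : WithTop ℕ∞) f (Ici 0)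
  bounded : ∀ k ≤ n, ∃ C : ℝ, ∀ t, 0 ≤ t → |iteratedDerivWithin k f (Ici 0) t| ≤ C
  piecewise : ∃ S : Set ℝ, (∀ T : ℝ, (S ∩ Icc 0 T).Finite) ∧
    (∀ t, 0 ≤ t → t ∉ S →
      DifferentiableWithinAt ℝ (iteratedDerivWithin (n - 1) f (Ici 0)) (Ici 0) t ∧
      ContinuousWithinAt (iteratedDerivWithin n f (Ici 0)) (Ici 0) t) ∧
    (∀ t ∈ S, 0 < t → ∃ l : ℝ, Tendsto (iteratedDerivWithin n f (Ici 0)) (𝓝[<] t) (𝓝 l)) ∧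
    (∀ t ∈ S, 0 ≤ t → ∃ l : ℝ, Tendsto (iteratedDerivWithin n f (Ici 0)) (𝓝[>] t) (𝓝 l))

/-- Performance functions on `[0, ∞)`: positive, decreasing, with a positive limit, and with
bounded piecewise continuous derivatives up to order `n`. -/
structure IsPerformanceFunction (n : ℕ) (r : ℝ → ℝ) : Prop where
  pos : ∀ t, 0 ≤ t → 0 < r t
  antitone : AntitoneOn r (Ici 0)
  limit : ∃ rInf : ℝ, 0 < rInf ∧ Tendsto r atTop (𝓝 rInf)
  derivs : HasBoundedPiecewiseDerivs n r

/-- The logarithmic error transformation. -/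
def errorTransform (z : ℝ) : ℝ := Real.log ((1 + z) / (1 - z))

/-- The gain `1 / (1 - z ^ 2)`. -/
def errorGain (z : ℝ) : ℝ := 1 / (1 - z ^ 2)

/-- The data of a network of `N` filters of order `n`: the connectivity matrix `a` of the
followers (`a i j > 0` when `i` receives information from `j`), the leader-access indicators `b`,
the filter constant `lam`, the gains `c`, the performance functions `rho`, and the leader
trajectory `y0`. -/
structure FilterNetwork (N n : ℕ) where
  a : Matrix (Fin N) (Fin N) ℝ
  b : Fin N → ℝ
  lam : ℝ
  c : Fin N → ℝ
  rho : Fin N → ℝ → ℝ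
  y0 : ℝ → ℝ

namespace FilterNetwork

variable {N n : ℕ} (F : FilterNetwork N n)

/-- The augmented directed graph: the leader is `none`, and `Adj u v` means that `v` receives
information from `u`. -/
def augmentedGraph : Digraph (Option (Fin N)) where
  Adj u v := match u, v with
    | some j, some i => 0 < F.a i j
    | none, some i => F.b i = 1
    | _, none => False

/-- There are directed paths from the leader to all nodes, that is, the augmented graph has a
directed spanning tree rooted at the leader. -/
def HasLeaderRootedSpanningTree : Prop :=
  ∀ v, Relation.ReflTransGen F.augmentedGraph.Adj none v

/-- The state of the filters at time `t` along the trajectories `y i` with time domain `D`: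
the derivatives of order `0, …, n - 1`. -/
def state (_ : FilterNetwork N n) (D : Set ℝ) (y : Fin N → ℝ → ℝ) (t : ℝ)
    (i : Fin N) (k : Fin n) : ℝ :=
  iteratedDerivWithin k (y i) D t

/-- The `k`-th derivative of the estimation error `y i - y0`, at the filter state `X`. -/
def delta (t : ℝ) (X : Fin N → Fin n → ℝ) (i : Fin N) (k : Fin n) : ℝ :=
  X i k - iteratedDerivWithin k F.y0 (Ici 0) t

/-- The `k`-th derivative of the neighbourhood error
`z i = ∑ j, a i j * (y i - y j) + b i * (y i - y0)`, at the filter state `X`. -/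
def consensusError (t : ℝ) (X : Fin N → Fin n → ℝ) (i : Fin N) (k : Fin n) : ℝ :=
  ∑ j, F.a i j * (X i k - X j k) + F.b i * (X i k - iteratedDerivWithin k F.y0 (Ici 0) t)

/-- `(d/dt + lam) ^ (n - 1)` applied to `z i`, at the filter state `X`;
here `k.rev` is `n - 1 - k`. -/
def zbar (t : ℝ) (X : Fin N → Fin n → ℝ) (i : Fin N) : ℝ :=
  ∑ k : Fin n, ((n - 1).choose k : ℝ) * F.lam ^ (k : ℕ) * F.consensusError t X i k.rev

/-- The normalized error. -/
def zeta (t : ℝ) (X : Fin N → Fin n → ℝ) (i : Fin N) : ℝ := F.zbar t X i / F.rho i t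

/-- The distributed filter input. -/
def nu (t : ℝ) (X : Fin N → Fin n → ℝ) (i : Fin N) : ℝ :=
  -(F.c i / F.rho i t) * (errorGain (F.zeta t X i) * errorTransform (F.zeta t X i))

/-- The trajectories `y i` solve the closed-loop filter equations on the time domain `D`: they are
`n` times differentiable and the `n`-th derivative of `y i` is the input `nu i`. -/
def IsSolution (D : Set ℝ) (y : Fin N → ℝ → ℝ) : Prop :=
  ∀ i, ContDiffOn ℝ ((n - 1 : ℕ) : WithTop ℕ∞) (y i) D ∧
    ∀ t ∈ D, HasDerivWithinAt (iteratedDerivWithin (n - 1) (y i) D)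
      (F.nu t (F.state D y t) i) D t

/-- At time `t` and filter state `X`, all signals of the closed loop are at most `K` in absolute
value. -/
def SignalsBoundedBy (K t : ℝ) (X : Fin N → Fin n → ℝ) : Prop :=
  ∀ i, (∀ k, |X i k| ≤ K) ∧ (∀ k, |F.delta t X i k| ≤ K) ∧
    (∀ k, |F.consensusError t X i k| ≤ K) ∧ |F.zbar t X i| ≤ K ∧ |F.zeta t X i| ≤ K ∧
    |errorTransform (F.zeta t X i)| ≤ K ∧ |errorGain (F.zeta t X i)| ≤ K ∧ |F.nu t X i| ≤ K

/-- Along differentiable trajectories `zbar` is the differential operator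
`(d/dt + lam) ^ (n - 1)`, in its binomial expansion, applied to the function `z i`. -/
theorem zbar_state_eq {y : Fin N → ℝ → ℝ}
    (hy : ∀ i, ContDiffOn ℝ ((n - 1 : ℕ) : WithTop ℕ∞) (y i) (Ici 0))
    (h0 : ContDiffOn ℝ ((n - 1 : ℕ) : WithTop ℕ∞) F.y0 (Ici 0)) {t : ℝ} (ht : 0 ≤ t)
    (i : Fin N) :
    F.zbar t (F.state (Ici 0) y t) i =
      ∑ k ∈ Finset.range n, ((n - 1).choose k : ℝ) * F.lam ^ k *
        iteratedDerivWithin (n - 1 - k)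
          (fun s => ∑ j, F.a i j * (y i s - y j s) + F.b i * (y i s - F.y0 s)) (Ici 0) t := by
  have hu : UniqueDiffOn ℝ (Ici (0 : ℝ)) := uniqueDiffOn_Ici 0
  have htm : t ∈ Ici (0 : ℝ) := ht
  rw [← Fin.sum_univ_eq_sum_range (fun k => ((n - 1).choose k : ℝ) * F.lam ^ k *
        iteratedDerivWithin (n - 1 - k)
          (fun s => ∑ j, F.a i j * (y i s - y j s) + F.b i * (y i s - F.y0 s)) (Ici 0) t)]
  unfold zbar
  refine Finset.sum_congr rfl fun k _ => ?_
  congr 1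
  have hk : ((k.rev : Fin n) : ℕ) = n - 1 - k := by rw [Fin.val_rev]; omega
  have hle : (((n - 1 - (k : ℕ) : ℕ)) : WithTop ℕ∞) ≤ ((n - 1 : ℕ) : WithTop ℕ∞) := by
    exact_mod_cast Nat.sub_le _ _
  have hy' : ∀ j, ContDiffWithinAt ℝ ((n - 1 - (k : ℕ) : ℕ) : WithTop ℕ∞) (y j) (Ici 0) t :=
    fun j => ((hy j).of_le hle) t htm
  have h0' := (h0.of_le hle) t htm
  have hsub : ∀ j, ContDiffWithinAt ℝ ((n - 1 - (k : ℕ) : ℕ) : WithTop ℕ∞)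
      (fun s => F.a i j * (y i s - y j s)) (Ici 0) t :=
    fun j => contDiffWithinAt_const.mul ((hy' i).sub (hy' j))
  have hd : ∀ {f g : ℝ → ℝ},
      ContDiffWithinAt ℝ ((n - 1 - (k : ℕ) : ℕ) : WithTop ℕ∞) f (Ici 0) t →
      ContDiffWithinAt ℝ ((n - 1 - (k : ℕ) : ℕ) : WithTop ℕ∞) g (Ici 0) t →
      iteratedDerivWithin (n - 1 - (k : ℕ)) (fun s => f s - g s) (Ici 0) t =
        iteratedDerivWithin (n - 1 - (k : ℕ)) f (Ici 0) t -
          iteratedDerivWithin (n - 1 - (k : ℕ)) g (Ici 0) t :=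
    fun hf hg => iteratedDerivWithin_sub htm hu hf hg
  unfold consensusError state
  rw [hk, iteratedDerivWithin_fun_add htm hu (ContDiffWithinAt.sum fun j _ => hsub j)
      (contDiffWithinAt_const.mul ((hy' i).sub h0')),
    iteratedDerivWithin_fun_sum htm hu (fun j _ => hsub j),
    iteratedDerivWithin_const_mul htm hu _ ((hy' i).sub h0'),
    hd (hy' i) h0']
  congr 1
  refine Finset.sum_congr rfl fun j _ => ?_
  rw [iteratedDerivWithin_const_mul htm hu _ ((hy' i).sub (hy' j)),
    hd (hy' i) (hy' j)]

end FilterNetwork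

end

noncomputable section

/-! The argument rests on a priori bounds that are uniform over all arcs, that is, over pieces of
closed-loop trajectory on `[0, T)` with `|ζ_i| < 1`; the constants do not depend on `T`.

Write `H` for the Laplacian of the followers plus `diag b`. Reachability from the leader makes `H` a
nonsingular M-matrix, so some positive diagonal weight `p` satisfies `∑ p_i x_i (H x)_i ≥ κ |x|²`
(`exists_diagonal_weight_followerMatrix`). On an arc `|zbar_i| < ρ_i`. Undoing the stable filters
`d/dt + λ` one at a time bounds all derivatives of `z_i` of order `< n`
(`ultimatelyBounded_filteredError`), and `H⁻¹` carries these bounds to the tracking errors and the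
states. Hence `ρ_i ζ_i' = (H ν)_i + e_i` with `e_i` bounded. Since `c_i M_i O_i / ρ_i = -ν_i`, the
function `V = ∑ p_i c_i O_i² / 2` satisfies `V' = -2 ∑ p_i ν_i ((H ν)_i + e_i)`. This is at most `-κ
|ν|²` plus a bounded term, and `|ν|²` dominates a multiple of `V`. Thus `O_i` is bounded
(`ultimatelyBounded_errorTransform`), which keeps `ζ_i` away from `±1` and bounds `M_i` and `ν_i`.

Global existence follows by solving a saturated system, which is bounded and Lipschitz, and
observing that the bounds keep the saturation inactive. The same bounds show that no solution can
leave `|ζ_i| < 1`, and they reduce uniqueness to the Lipschitz case. The vector field is continuous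
in time, because `y0^(n)` and `ρ_i'` enter only through `ζ_i'`; their jumps affect the differential
inequalities on a locally finite set of times only. -/

theorem exists_pos_forall_le_of_pos {ι : Type*} [Finite ι] {f : ι → ℝ} (hf : ∀ i, 0 < f i) :
    ∃ c : ℝ, 0 < c ∧ ∀ i, c ≤ f i := by
  cases nonempty_fintype ι
  rcases isEmpty_or_nonempty ι with h | h
  · exact ⟨1, one_pos, fun i => h.elim i⟩
  · obtain ⟨i, hi⟩ := Finite.exists_min f
    exact ⟨f i, hf i, hi⟩

/-! ### The follower matrix as a nonsingular M-matrix -/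

/-- A matrix with nonpositive off-diagonal entries, weighted so that its row sums are `q` and its
column sums are `w`, has a quadratic form bounded below by the mean of `q` and `w`. -/
theorem sum_mul_mul_ge_of_offDiag_nonpos {ι : Type*} [Fintype ι] {G : ι → ι → ℝ}
    {q w : ι → ℝ} (hG : ∀ i j, i ≠ j → G i j ≤ 0) (hq : ∀ i, ∑ j, G i j = q i)
    (hw : ∀ j, ∑ i, G i j = w j) (y : ι → ℝ) :
    ∑ i, (q i + w i) / 2 * y i ^ 2 ≤ ∑ i, ∑ j, G i j * (y i * y j) := by
  -- Polarization: `y_i y_j = y_i² / 2 + y_j² / 2 - (y_i - y_j)² / 2`. The diagonal drops out of the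
  -- last term, so only the off-diagonal signs matter.
  have h1 : ∑ i, ∑ j, G i j * (y i * y j) =
      ∑ i, q i / 2 * y i ^ 2 + ∑ i, w i / 2 * y i ^ 2 -
        ∑ i, ∑ j, G i j * ((y i - y j) ^ 2 / 2) := by
    have e1 : ∑ i, q i / 2 * y i ^ 2 = ∑ i, ∑ j, G i j * (y i ^ 2 / 2) := by
      refine Finset.sum_congr rfl fun i _ => ?_
      rw [← Finset.sum_mul, hq]; ring
    have e2 : ∑ i, w i / 2 * y i ^ 2 = ∑ i, ∑ j, G i j * (y j ^ 2 / 2) := by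
      rw [Finset.sum_comm]
      refine Finset.sum_congr rfl fun i _ => ?_
      rw [← Finset.sum_mul, hw]; ring
    rw [e1, e2, ← Finset.sum_add_distrib, ← Finset.sum_sub_distrib]
    refine Finset.sum_congr rfl fun i _ => ?_
    rw [← Finset.sum_add_distrib, ← Finset.sum_sub_distrib]
    exact Finset.sum_congr rfl fun j _ => by ring
  have h2 : ∑ i, ∑ j, G i j * ((y i - y j) ^ 2 / 2) ≤ 0 := by
    refine Finset.sum_nonpos fun i _ => Finset.sum_nonpos fun j _ => ?_
    rcases eq_or_ne i j with rfl | h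
    · simp
    · exact mul_nonpos_of_nonpos_of_nonneg (hG i j h) (by positivity)
  have h3 : ∑ i, (q i + w i) / 2 * y i ^ 2 =
      ∑ i, q i / 2 * y i ^ 2 + ∑ i, w i / 2 * y i ^ 2 := by
    rw [← Finset.sum_add_distrib]
    exact Finset.sum_congr rfl fun i _ => by ring
  linarith

namespace FilterNetwork
variable {N n : ℕ} (F : FilterNetwork N n)

/-- The Laplacian of the followers plus the diagonal matrix of the leader-access indicators. -/
def followerMatrix : Matrix (Fin N) (Fin N) ℝ :=
  Matrix.diagonal (fun i => ∑ j, F.a i j + F.b i) - F.a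

theorem followerMatrix_mulVec (x : Fin N → ℝ) (i : Fin N) :
    (F.followerMatrix.mulVec x) i = ∑ j, F.a i j * (x i - x j) + F.b i * x i := by
  rw [followerMatrix, Matrix.sub_mulVec, Pi.sub_apply, Matrix.mulVec_diagonal]
  simp only [Matrix.mulVec, dotProduct, mul_sub, Finset.sum_sub_distrib, ← Finset.sum_mul]
  ring

variable {F}

/-- The minimum principle for the follower matrix. -/
theorem nonneg_of_followerMatrix_mulVec_nonneg (ha : ∀ i j, 0 ≤ F.a i j)
    (hb : ∀ i, F.b i = 0 ∨ F.b i = 1) (htree : F.HasLeaderRootedSpanningTree)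
    {x : Fin N → ℝ} (hx : ∀ i, 0 ≤ (F.followerMatrix.mulVec x) i) (i : Fin N) : 0 ≤ x i := by
  by_contra! hneg
  have : Nonempty (Fin N) := ⟨i⟩
  obtain ⟨m, hm⟩ := Finite.exists_min x
  have hm0 : x m < 0 := (hm i).trans_lt hneg
  have hb0 : ∀ i, 0 ≤ F.b i := fun i => by rcases hb i with h | h <;> rw [h]; norm_num
  -- At a node with the negative minimal value all terms of `(H x)_k` are nonpositive while their
  -- sum is nonnegative, so all vanish. An edge from the leader is then impossible, and an edge from
  -- a follower passes the minimum back to it. Induction along the path from the leader excludes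
  -- every node.
  have key : ∀ v, Relation.ReflTransGen F.augmentedGraph.Adj none v →
      ∀ k, v = some k → x k ≠ x m := by
    intro v hv
    induction hv with
    | refl => intro k hk; simp at hk
    | @tail u v _ huv ih =>
      rintro k rfl hk
      have hsum := hx k
      rw [followerMatrix_mulVec] at hsum
      have hle : ∀ j, F.a k j * (x k - x j) ≤ 0 := fun j =>
        mul_nonpos_of_nonneg_of_nonpos (ha k j) (by rw [hk]; linarith [hm j])
      have hbk : F.b k * x k ≤ 0 :=
        mul_nonpos_of_nonneg_of_nonpos (hb0 k) (by rw [hk]; exact hm0.le)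
      have hs : ∑ j, F.a k j * (x k - x j) ≤ 0 := Finset.sum_nonpos fun j _ => hle j
      match u, huv, ih with
      | none, huv, _ =>
        have h1 : F.b k = 1 := huv
        rw [h1, one_mul, hk] at hsum
        rw [hk] at hs
        linarith
      | some j, huv, ih =>
        have h1 : 0 < F.a k j := huv
        have h2 : ∑ j, F.a k j * (x k - x j) ≤ F.a k j * (x k - x j) := by
          rw [← Finset.add_sum_erase _ _ (Finset.mem_univ j)]
          linarith [Finset.sum_nonpos (s := Finset.univ.erase j) fun l _ => hle l]
        have h3 : F.a k j * (x k - x j) = 0 := le_antisymm (hle j) (by linarith)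
        rcases mul_eq_zero.1 h3 with h4 | h4
        · exact h1.ne' h4
        · exact ih j rfl (by linarith)
  exact key _ (htree (some m)) m rfl rfl

/-- The minimum principle, applied to a difference of two vectors and to its negative, gives
injectivity. -/
theorem isUnit_followerMatrix (ha : ∀ i j, 0 ≤ F.a i j)
    (hb : ∀ i, F.b i = 0 ∨ F.b i = 1) (htree : F.HasLeaderRootedSpanningTree) :
    IsUnit F.followerMatrix := by
  rw [← Matrix.mulVec_injective_iff_isUnit]
  intro x y hxy
  have h : ∀ x y : Fin N → ℝ, F.followerMatrix.mulVec x = F.followerMatrix.mulVec y →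
      ∀ i, 0 ≤ (x - y) i := fun x y hxy =>
    nonneg_of_followerMatrix_mulVec_nonneg ha hb htree fun i => by
      rw [Matrix.mulVec_sub, hxy, sub_self]; rfl
  funext i
  have h1 := h x y hxy i
  have h2 := h y x hxy.symm i
  simp only [Pi.sub_apply] at h1 h2
  linarith

/-- The columns of the inverse solve `H x = e_j ≥ 0`, so the minimum principle applies to them. -/
theorem followerMatrix_inv_nonneg (ha : ∀ i j, 0 ≤ F.a i j)
    (hb : ∀ i, F.b i = 0 ∨ F.b i = 1) (htree : F.HasLeaderRootedSpanningTree) (i j : Fin N) :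
    0 ≤ F.followerMatrix⁻¹ i j := by
  have hu := (Matrix.isUnit_iff_isUnit_det _).1 (isUnit_followerMatrix ha hb htree)
  have h := nonneg_of_followerMatrix_mulVec_nonneg ha hb htree
    (x := F.followerMatrix⁻¹.mulVec (Pi.single j 1)) (fun k => by
      rw [Matrix.mulVec_mulVec, Matrix.mul_nonsing_inv _ hu, Matrix.one_mulVec, Pi.single_apply]
      split_ifs <;> norm_num) i
  simpa using h

/-- The follower matrix is positive definite with respect to a diagonal weight. -/
theorem exists_diagonal_weight_followerMatrix (ha : ∀ i j, 0 ≤ F.a i j)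
    (hb : ∀ i, F.b i = 0 ∨ F.b i = 1) (htree : F.HasLeaderRootedSpanningTree) :
    ∃ (p : Fin N → ℝ) (κ : ℝ), (∀ i, 0 < p i) ∧ 0 < κ ∧
      ∀ x : Fin N → ℝ, κ * ∑ i, x i ^ 2 ≤ ∑ i, p i * x i * (F.followerMatrix.mulVec x) i := by
  set H := F.followerMatrix with hH
  have hu := (Matrix.isUnit_iff_isUnit_det _).1 (isUnit_followerMatrix ha hb htree)
  have hnn := followerMatrix_inv_nonneg ha hb htree
  -- With `H w = 1` and `qᵀ H = 1`, the matrix `q_i H_ij w_j` has row sums `q` and column sums `w`.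
  -- The substitution `x = w y` turns its quadratic form into that of `H` with weight `p = q / w`.
  -- Positivity of `q` and `w` holds since the nonnegative invertible `H⁻¹` has no zero row or
  -- column.
  set w : Fin N → ℝ := fun i => ∑ j, H⁻¹ i j with hw
  set q : Fin N → ℝ := fun j => ∑ i, H⁻¹ i j with hq
  have hwpos : ∀ i, 0 < w i := fun i => by
    refine lt_of_le_of_ne (Finset.sum_nonneg fun j _ => hnn i j) fun h => ?_
    have h0 := (Finset.sum_eq_zero_iff_of_nonneg fun j _ => hnn i j).1 h.symm
    have h1 : (H⁻¹ * H) i i = 1 := by rw [Matrix.nonsing_inv_mul _ hu, Matrix.one_apply_eq]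
    rw [Matrix.mul_apply, Finset.sum_eq_zero fun j hj => by rw [h0 j hj, zero_mul]] at h1
    exact zero_ne_one h1
  have hqpos : ∀ i, 0 < q i := fun i => by
    refine lt_of_le_of_ne (Finset.sum_nonneg fun j _ => hnn j i) fun h => ?_
    have h0 := (Finset.sum_eq_zero_iff_of_nonneg fun j _ => hnn j i).1 h.symm
    have h1 : (H * H⁻¹) i i = 1 := by rw [Matrix.mul_nonsing_inv _ hu, Matrix.one_apply_eq]
    rw [Matrix.mul_apply, Finset.sum_eq_zero fun j hj => by rw [h0 j hj, mul_zero]] at h1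
    exact zero_ne_one h1
  have hHw : ∀ i, ∑ j, H i j * w j = 1 := fun i => by
    simp only [hw, Finset.mul_sum]
    rw [Finset.sum_comm]
    have h : ∀ k, ∑ j, H i j * H⁻¹ j k = (1 : Matrix (Fin N) (Fin N) ℝ) i k := fun k => by
      rw [← Matrix.mul_apply, Matrix.mul_nonsing_inv _ hu]
    simp [h, Matrix.one_apply]
  have hqH : ∀ j, ∑ i, q i * H i j = 1 := fun j => by
    simp only [hq, Finset.sum_mul]
    rw [Finset.sum_comm]
    have h : ∀ k, ∑ i, H⁻¹ k i * H i j = (1 : Matrix (Fin N) (Fin N) ℝ) k j := fun k => by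
      rw [← Matrix.mul_apply, Matrix.nonsing_inv_mul _ hu]
    simp [h, Matrix.one_apply]
  obtain ⟨κ, hκ, hκle⟩ := exists_pos_forall_le_of_pos
    (f := fun i => (q i + w i) / 2 / w i ^ 2)
    (fun i => by have := hwpos i; have := hqpos i; positivity)
  refine ⟨fun i => q i / w i, κ, fun i => div_pos (hqpos i) (hwpos i), hκ, fun x => ?_⟩
  have hform := sum_mul_mul_ge_of_offDiag_nonpos (G := fun i j => q i * H i j * w j)
    (q := q) (w := w) (fun i j hij => ?_) (fun i => ?_) (fun j => ?_) (fun i => x i / w i)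
  · calc κ * ∑ i, x i ^ 2 ≤ ∑ i, (q i + w i) / 2 * (x i / w i) ^ 2 := by
          rw [Finset.mul_sum]
          refine Finset.sum_le_sum fun i _ => ?_
          calc κ * x i ^ 2 ≤ (q i + w i) / 2 / w i ^ 2 * x i ^ 2 :=
                mul_le_mul_of_nonneg_right (hκle i) (sq_nonneg _)
            _ = _ := by ring
      _ ≤ _ := hform
      _ = _ := by
          refine Finset.sum_congr rfl fun i _ => ?_
          simp only [Matrix.mulVec, dotProduct, Finset.mul_sum]
          refine Finset.sum_congr rfl fun j _ => ?_
          have := (hwpos j).ne'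
          field_simp
  · have hHij : H i j = - F.a i j := by
      simp [hH, followerMatrix, Matrix.diagonal_apply_ne _ hij]
    rw [hHij]
    have := mul_nonneg (mul_nonneg (hqpos i).le (ha i j)) (hwpos j).le
    linarith
  · simp only [mul_assoc, ← Finset.mul_sum, hHw, mul_one]
  · simp only [← Finset.sum_mul, hqH, one_mul]

end FilterNetwork

/-! ### Comparison and continuation arguments on an interval -/

/-- A continuous function whose derivative is nonpositive off a finite set does not increase. -/
theorem le_of_hasDerivAt_nonpos_off_finite {S : Set ℝ} (hS : S.Finite) :
    ∀ {f : ℝ → ℝ} {a b : ℝ}, a ≤ b → ContinuousOn f (Icc a b) →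
      (∀ t ∈ Ioo a b, t ∉ S → ∃ f', HasDerivAt f f' t ∧ f' ≤ 0) → f b ≤ f a := by
  induction S, hS using Set.Finite.induction_on with
  | empty =>
    intro f a b hab hf hd
    refine antitoneOn_of_deriv_nonpos (convex_Icc a b) hf ?_ ?_ (left_mem_Icc.2 hab)
      (right_mem_Icc.2 hab) hab
    · rw [interior_Icc]
      intro t ht
      obtain ⟨f', h, -⟩ := hd t ht (notMem_empty t)
      exact h.differentiableAt.differentiableWithinAt
    · rw [interior_Icc]
      intro t ht
      obtain ⟨f', h, h'⟩ := hd t ht (notMem_empty t)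
      rwa [h.deriv]
  | @insert s S _ _ ih =>
    intro f a b hab hf hd
    by_cases hs : s ∈ Ioo a b
    · have h1 : f s ≤ f a := ih hs.1.le (hf.mono (Icc_subset_Icc_right hs.2.le))
        fun t ht htS => hd t ⟨ht.1, ht.2.trans hs.2⟩ fun h =>
          h.elim (fun h => ht.2.ne h) htS
      have h2 : f b ≤ f s := ih hs.2.le (hf.mono (Icc_subset_Icc_left hs.1.le))
        fun t ht htS => hd t ⟨hs.1.trans ht.1, ht.2⟩ fun h =>
          h.elim (fun h => ht.1.ne' h) htS
      exact h2.trans h1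
    · exact ih hab hf fun t ht htS => hd t ht fun h =>
        h.elim (fun h => hs (h ▸ ht)) htS

/-- A function that decreases at rate `α` wherever it exceeds the level `m` is bounded by the
larger of `m` and the corresponding linear function. -/
theorem le_max_of_deriv_le_neg_above {S : Set ℝ} (hS : S.Finite) {f : ℝ → ℝ} {a b m α : ℝ}
    (hα : 0 ≤ α) (hab : a ≤ b) (hf : ContinuousOn f (Icc a b))
    (hd : ∀ t ∈ Ioo a b, t ∉ S → m ≤ f t → ∃ f', HasDerivAt f f' t ∧ f' ≤ -α) :
    f b ≤ max m (f a - α * (b - a)) := by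
  by_contra! hlt
  obtain ⟨hm, hl⟩ := max_lt_iff.1 hlt
  have slope : ∀ s ∈ Icc a b, (∀ t ∈ Ioo s b, m ≤ f t) → f b ≤ f s - α * (b - s) := by
    intro s hs hst
    have h := le_of_hasDerivAt_nonpos_off_finite hS (f := fun t => f t + α * t) hs.2
      ((hf.mono (Icc_subset_Icc_left hs.1)).add (by fun_prop)) (fun t ht htS => by
        obtain ⟨f', h1, h2⟩ := hd t ⟨hs.1.trans_lt ht.1, ht.2⟩ htS (hst t ht)
        exact ⟨f' + α * 1, h1.add ((hasDerivAt_id t).const_mul α), by linarith⟩)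
    linarith
  -- After the last time at which `f ≤ m`, the slope bound applies up to `b` and forces `f b ≤ m`.
  -- If there is no such time, it applies from `a`.
  set B : Set ℝ := Icc a b ∩ f ⁻¹' Iic m with hB
  have hBc : IsClosed B := hf.preimage_isClosed_of_isClosed isClosed_Icc isClosed_Iic
  rcases B.eq_empty_or_nonempty with he | hne
  · have := slope a (left_mem_Icc.2 hab) fun t ht => by
      by_contra! h
      exact (he ▸ (show t ∈ B from ⟨⟨ht.1.le, ht.2.le⟩, h.le⟩) : t ∈ (∅ : Set ℝ))
    linarith
  · have hbdd : BddAbove B := ⟨b, fun t ht => ht.1.2⟩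
    have hs : sSup B ∈ B := hBc.csSup_mem hne hbdd
    have := slope (sSup B) hs.1 fun t ht => by
      by_contra! h
      exact absurd (le_csSup hbdd (show t ∈ B from ⟨⟨hs.1.1.trans ht.1.le, ht.2.le⟩, h.le⟩))
        (not_le.2 ht.1)
    have h1 : f (sSup B) ≤ m := hs.2
    have h2 : 0 ≤ α * (b - sSup B) := mul_nonneg hα (by linarith [hs.1.2])
    linarith

/-- A property that holds initially, is open, and persists at the end of every interval on which
it holds, holds on the whole interval. -/
theorem forall_mem_Ico_of_open_of_persists {T : ℝ} {G : ℝ → Prop} (h0 : G 0)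
    (hopen : ∀ t ∈ Ico 0 T, G t → ∀ᶠ s in 𝓝[Ico 0 T] t, G s)
    (hstep : ∀ t ∈ Ico 0 T, 0 < t → (∀ s ∈ Ico 0 t, G s) → G t) :
    ∀ t ∈ Ico 0 T, G t := by
  intro t ht
  by_contra hneg
  set B : Set ℝ := {s | s ∈ Ico 0 T ∧ ¬ G s} with hB
  have hne : B.Nonempty := ⟨t, ht, hneg⟩
  have hbdd : BddBelow B := ⟨0, fun s hs => hs.1.1⟩
  have hi0 : 0 ≤ sInf B := le_csInf hne fun s hs => hs.1.1
  have hiT : sInf B ∈ Ico 0 T := ⟨hi0, (csInf_le hbdd ⟨ht, hneg⟩).trans_lt ht.2⟩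
  have hlt : ∀ s ∈ Ico 0 (sInf B), G s := fun s hs => by
    by_contra h
    exact absurd (csInf_le hbdd ⟨⟨hs.1, hs.2.trans hiT.2⟩, h⟩) (not_le.2 hs.2)
  have hG : G (sInf B) := by
    rcases hi0.eq_or_lt with h | h
    · rwa [← h]
    · exact hstep _ hiT h hlt
  obtain ⟨δ, hδ, hball⟩ := Metric.mem_nhdsWithin_iff.1 (hopen _ hiT hG)
  obtain ⟨s, hs, hsδ⟩ := exists_lt_of_csInf_lt hne (show sInf B < sInf B + δ by linarith)
  refine hs.2 (hball ⟨?_, hs.1⟩)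
  rw [Metric.mem_ball, Real.dist_eq, abs_of_nonneg (by linarith [csInf_le hbdd hs])]
  linarith

/-! ### A calculus of ultimately bounded signals -/

open Asymptotics

/-- The filters along which the signals of a family of trajectories are to be bounded: each set
`A p` of pairs of a trajectory and a time, and large times, uniformly over each `A p`
but with the same bound for all `p`. -/
def ultimateFilter {S P : Type*} (A : P → Set (S × ℝ)) : Option P → Filter (S × ℝ)
  | some p => 𝓟 (A p)
  | none => ⨆ p, 𝓟 (A p) ⊓ comap Prod.snd atTop

/-- Semi-global uniform ultimate boundedness of a signal. -/
def UltimatelyBounded {S P : Type*} (A : P → Set (S × ℝ)) {E : Type*} [Norm E]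
    (g : S × ℝ → E) : Prop :=
  ∀ o, g =O[ultimateFilter A o] (fun _ => (1 : ℝ))

section UltimatelyBounded

variable {S P : Type*} {A : P → Set (S × ℝ)}

/-- The supremum over `p` in the filter for `none` is what makes `μ` common to all classes, while
`τ` may depend on `p`. Phrasing this as `O(1)` along filters gives sums, products and tuples from
the calculus of `IsBigO`. -/
theorem ultimatelyBounded_iff {E : Type*} [Norm E] {g : S × ℝ → E} :
    UltimatelyBounded A g ↔ ∃ μ : ℝ, ∀ p, ∃ K τ : ℝ, ∀ x ∈ A p,
      ‖g x‖ ≤ K ∧ (τ ≤ x.2 → ‖g x‖ ≤ μ) := by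
  have hnone : ∀ μ : ℝ, (∀ᶠ x in ultimateFilter A none, ‖g x‖ ≤ μ) ↔
      ∀ p, ∃ τ : ℝ, ∀ x ∈ A p, τ ≤ x.2 → ‖g x‖ ≤ μ := fun μ => by
    simp only [ultimateFilter, eventually_iSup]
    refine forall_congr' fun p => ?_
    rw [inf_comm, eventually_inf_principal, eventually_comap, eventually_atTop]
    constructor
    · rintro ⟨τ, h⟩
      exact ⟨τ, fun x hx hτ => h x.2 hτ x rfl hx⟩
    · rintro ⟨τ, h⟩
      exact ⟨τ, fun t ht x hx hA => h x hA (hx ▸ ht)⟩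
  constructor
  · intro h
    obtain ⟨μ, hμ⟩ := (h none).bound
    simp only [norm_one, mul_one] at hμ
    refine ⟨μ, fun p => ?_⟩
    obtain ⟨K, hK⟩ := (h (some p)).bound
    obtain ⟨τ, hτ⟩ := (hnone μ).1 hμ p
    simp only [norm_one, mul_one] at hK
    exact ⟨K, τ, fun x hx => ⟨hK hx, hτ x hx⟩⟩
  · rintro ⟨μ, h⟩ (_ | p)
    · refine IsBigO.of_bound μ ?_
      simp only [norm_one, mul_one]
      exact (hnone μ).2 fun p => let ⟨K, τ, h⟩ := h p; ⟨τ, fun x hx => (h x hx).2⟩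
    · obtain ⟨K, τ, h⟩ := h p
      refine IsBigO.of_bound K ?_
      simp only [norm_one, mul_one]
      exact fun x hx => (h x hx).1

namespace UltimatelyBounded

theorem eventually_mem (o : Option P) : ∀ᶠ x in ultimateFilter A o, ∃ p, x ∈ A p := by
  rcases o with _ | p
  · simp only [ultimateFilter, eventually_iSup]
    exact fun p => Eventually.filter_mono inf_le_left fun x hx => ⟨p, hx⟩
  · exact fun x hx => ⟨p, hx⟩

variable {f g : S × ℝ → ℝ}

theorem of_norm_le {E E' : Type*} [Norm E] [SeminormedAddCommGroup E']
    {f : S × ℝ → E} {g : S × ℝ → E'}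
    (hg : UltimatelyBounded A g) (h : ∀ p, ∀ x ∈ A p, ‖f x‖ ≤ ‖g x‖) : UltimatelyBounded A f :=
  fun o => (IsBigO.of_bound 1 ((eventually_mem o).mono fun x ⟨p, hx⟩ => by
    simpa using h p x hx)).trans (hg o)

theorem congr_on (hg : UltimatelyBounded A g) (h : ∀ p, ∀ x ∈ A p, f x = g x) :
    UltimatelyBounded A f :=
  hg.of_norm_le fun p x hx => by rw [h p x hx]

theorem const (c : ℝ) : UltimatelyBounded A (fun _ => c) :=
  fun _ => isBigO_const_const c one_ne_zero _

theorem of_abs_le (C : ℝ) (h : ∀ p, ∀ x ∈ A p, |f x| ≤ C) : UltimatelyBounded A f :=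
  (const C).of_norm_le fun p x hx => (h p x hx).trans (le_abs_self C)

theorem add (hf : UltimatelyBounded A f) (hg : UltimatelyBounded A g) :
    UltimatelyBounded A (fun x => f x + g x) := fun o => (hf o).add (hg o)

theorem sub (hf : UltimatelyBounded A f) (hg : UltimatelyBounded A g) :
    UltimatelyBounded A (fun x => f x - g x) := fun o => (hf o).sub (hg o)

theorem mul (hf : UltimatelyBounded A f) (hg : UltimatelyBounded A g) :
    UltimatelyBounded A (fun x => f x * g x) := fun o => by simpa using (hf o).mul (hg o)

theorem const_mul (c : ℝ) (hf : UltimatelyBounded A f) :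
    UltimatelyBounded A (fun x => c * f x) := (const c).mul hf

theorem pow (hf : UltimatelyBounded A f) (k : ℕ) :
    UltimatelyBounded A (fun x => f x ^ k) := fun o => by simpa using (hf o).pow k

theorem sum {ι : Type*} {s : Finset ι} {f : ι → S × ℝ → ℝ}
    (hf : ∀ i ∈ s, UltimatelyBounded A (f i)) :
    UltimatelyBounded A (fun x => ∑ i ∈ s, f i x) := fun o =>
  IsBigO.fun_sum fun i hi => hf i hi o

theorem pi {ι : Type*} [Fintype ι] {E : ι → Type*} [∀ i, NormedAddCommGroup (E i)]
    {f : S × ℝ → ∀ i, E i} (hf : ∀ i, UltimatelyBounded A (fun x => f x i)) :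
    UltimatelyBounded A f := fun o => isBigO_pi.2 fun i => hf i o

theorem prodMk {E E' : Type*} [NormedAddCommGroup E] [NormedAddCommGroup E']
    {f : S × ℝ → E} {g : S × ℝ → E'} (hf : UltimatelyBounded A f)
    (hg : UltimatelyBounded A g) : UltimatelyBounded A (fun x => (f x, g x)) :=
  fun o => (hf o).prod_left (hg o)

/-- A signal that is bounded by a monotone function of a bounded signal. -/
theorem of_le_monotone {φ : ℝ → ℝ} (hφ : Monotone φ) (hg : UltimatelyBounded A g)
    (h : ∀ p, ∀ x ∈ A p, |f x| ≤ φ |g x|) : UltimatelyBounded A f := by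
  obtain ⟨μ, hμ⟩ := ultimatelyBounded_iff.1 hg
  refine ultimatelyBounded_iff.2 ⟨φ μ, fun p => ?_⟩
  obtain ⟨K, τ, hK⟩ := hμ p
  exact ⟨φ K, τ, fun x hx => ⟨(h p x hx).trans (hφ (hK x hx).1),
    fun hτ => (h p x hx).trans (hφ ((hK x hx).2 hτ))⟩⟩

/-- The comparison principle: a nonnegative signal `W` with `W' ≤ -β W + E`, where `E` is
bounded, is bounded. -/
theorem of_deriv_le {C : P → Set S} {T : S → ℝ}
    (hA : ∀ p s t, (s, t) ∈ A p ↔ s ∈ C p ∧ 0 ≤ t ∧ t < T s)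
    {W E : S × ℝ → ℝ} {β : ℝ} (hβ : 0 < β) (hE : UltimatelyBounded A E)
    (hW : ∀ p, ∀ x ∈ A p, 0 ≤ W x)
    (hcont : ∀ s, ContinuousOn (fun t => W (s, t)) (Ico 0 (T s)))
    {D : Set ℝ} (hD : ∀ t, (D ∩ Icc 0 t).Finite)
    (hderiv : ∀ s, ∀ t ∈ Ioo 0 (T s), t ∉ D → ∃ W', HasDerivAt (fun t => W (s, t)) W' t ∧
      W' ≤ -β * W (s, t) + E (s, t))
    (hinit : ∀ p, ∃ K, ∀ s ∈ C p, W (s, 0) ≤ K) : UltimatelyBounded A W := by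
  obtain ⟨μ, hμ⟩ := ultimatelyBounded_iff.1 hE
  -- Above the level `(μ + 1) / β` the bound `E ≤ μ` gives `W' ≤ -1`.
  refine ultimatelyBounded_iff.2 ⟨(μ + 1) / β, fun p => ?_⟩
  obtain ⟨K, τ, hK⟩ := hμ p
  obtain ⟨K0, hK0⟩ := hinit p
  have key : ∀ s ∈ C p, ∀ a b M, 0 ≤ a → a ≤ b → b < T s →
      (∀ t ∈ Ioo a b, E (s, t) ≤ M) →
      W (s, b) ≤ max ((M + 1) / β) (W (s, a) - 1 * (b - a)) := by
    intro s _ a b M ha hab hb hM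
    refine le_max_of_deriv_le_neg_above (f := fun t => W (s, t)) (hD b) zero_le_one hab
      ((hcont s).mono fun t ht => ⟨ha.trans ht.1, ht.2.trans_lt hb⟩) fun t ht htD hmt => ?_
    obtain ⟨W', h1, h2⟩ := hderiv s t ⟨ha.trans_lt ht.1, ht.2.trans hb⟩
      fun h => htD ⟨h, ha.trans ht.1.le, ht.2.le⟩
    refine ⟨W', h1, h2.trans ?_⟩
    rw [div_le_iff₀ hβ] at hmt
    linarith [hM t ht, mul_comm β (W (s, t))]
  set K1 := max ((K + 1) / β) K0 with hK1
  have hbd : ∀ s ∈ C p, ∀ t, 0 ≤ t → t < T s → W (s, t) ≤ K1 := fun s hs t h0 hT =>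
    (key s hs 0 t K le_rfl h0 hT fun r hr => (le_abs_self _).trans
      (hK (s, r) ((hA p s r).2 ⟨hs, hr.1.le, hr.2.trans hT⟩)).1).trans
      (max_le_max le_rfl (by linarith [hK0 s hs]))
  -- First `E` settles below `μ`; then `W ≤ K1` falls at unit rate, and so needs at most `K1 - (μ +
  -- 1) / β` further time.
  refine ⟨K1, max τ 0 + max (K1 - (μ + 1) / β) 0, ?_⟩
  rintro ⟨s, t⟩ hx
  have hx' := (hA p s t).1 hx
  rw [Real.norm_eq_abs, abs_of_nonneg (hW p _ hx)]
  refine ⟨hbd s hx'.1 t hx'.2.1 hx'.2.2, fun ht => ?_⟩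
  have hτ0 : 0 ≤ max τ 0 := le_max_right _ _
  have hτt : max τ 0 ≤ t := by
    have := le_max_right (K1 - (μ + 1) / β) 0
    simp only at ht
    linarith
  refine (key s hx'.1 (max τ 0) t μ hτ0 hτt hx'.2.2 fun r hr => (le_abs_self _).trans
      ((hK (s, r) ((hA p s r).2 ⟨hx'.1, hτ0.trans hr.1.le, hr.2.trans hx'.2.2⟩)).2
        ((le_max_left _ _).trans hr.1.le))).trans (max_le le_rfl ?_)
  have := hbd s hx'.1 (max τ 0) hτ0 (hτt.trans_lt hx'.2.2)
  have := le_max_left (K1 - (μ + 1) / β) 0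
  simp only at ht
  linarith

end UltimatelyBounded
end UltimatelyBounded

/-! ### Exogenous signals and the error transformation -/

theorem HasBoundedPiecewiseDerivs.exists_hasDerivAt {n : ℕ} {f : ℝ → ℝ}
    (hf : HasBoundedPiecewiseDerivs n f) :
    ∃ D : Set ℝ, (∀ t, (D ∩ Icc 0 t).Finite) ∧ ∀ t, 0 < t → t ∉ D → ∀ k < n,
      HasDerivAt (iteratedDerivWithin k f (Ici 0)) (iteratedDerivWithin (k + 1) f (Ici 0) t) t := by
  obtain ⟨D, hD, hdiff, -⟩ := hf.piecewise
  refine ⟨D, hD, fun t ht htD k hk => ?_⟩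
  have hd : DifferentiableWithinAt ℝ (iteratedDerivWithin k f (Ici 0)) (Ici 0) t := by
    rcases (Nat.le_sub_one_of_lt hk).eq_or_lt with h | h
    · exact h ▸ (hdiff t ht.le htD).1
    · exact (hf.contDiffOn.differentiableOn_iteratedDerivWithin (by exact_mod_cast h)
        (uniqueDiffOn_Ici 0)) t ht.le
  rw [iteratedDerivWithin_succ]
  exact hd.hasDerivWithinAt.hasDerivAt (Ici_mem_nhds ht)

theorem HasBoundedPiecewiseDerivs.continuousOn_iteratedDerivWithin {n : ℕ} {f : ℝ → ℝ}
    (hf : HasBoundedPiecewiseDerivs n f) {k : ℕ} (hk : k < n) :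
    ContinuousOn (iteratedDerivWithin k f (Ici 0)) (Ici 0) :=
  hf.contDiffOn.continuousOn_iteratedDerivWithin
    (by exact_mod_cast Nat.le_sub_one_of_lt hk) (uniqueDiffOn_Ici 0)

theorem one_le_errorGain {z : ℝ} (hz : |z| < 1) : 1 ≤ errorGain z := by
  have h := (sq_lt_one_iff_abs_lt_one z).2 hz
  rw [errorGain, le_div_iff₀ (by linarith)]
  linarith [sq_nonneg z]

theorem hasDerivAt_errorTransform {z : ℝ} (hz : |z| < 1) :
    HasDerivAt errorTransform (2 * errorGain z) z := by
  obtain ⟨h1, h2⟩ := abs_lt.1 hz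
  have h3 : (1 - z) ≠ 0 := by linarith
  have h4 : (1 + z) ≠ 0 := by linarith
  have h5 : 1 - z ^ 2 ≠ 0 := by
    rw [show 1 - z ^ 2 = (1 - z) * (1 + z) by ring]; exact mul_ne_zero h3 h4
  have h := (((hasDerivAt_id z).const_add 1).div ((hasDerivAt_id z).const_sub 1) h3).log
    (div_ne_zero h4 h3)
  refine h.congr_deriv ?_
  simp only [id, errorGain, Pi.div_apply]
  field_simp
  ring

/-- The right-hand side is `(1 + |z|) / (1 - |z|)`, which is `(1 + |z|)²` times the gain. A bound on
`O_i` therefore bounds `M_i`. -/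
theorem errorGain_le_exp_abs_errorTransform {z : ℝ} (hz : |z| < 1) :
    errorGain z ≤ Real.exp |errorTransform z| := by
  obtain ⟨h1, h2⟩ := abs_lt.1 hz
  have h3 : 0 < 1 - z := by linarith
  have h4 : 0 < 1 + z := by linarith
  have e1 : Real.exp (errorTransform z) = (1 + z) / (1 - z) := Real.exp_log (div_pos h4 h3)
  have e2 : Real.exp (-errorTransform z) = (1 - z) / (1 + z) := by
    rw [Real.exp_neg, e1, inv_div]
  have h5 : errorGain z = 1 / ((1 - z) * (1 + z)) := by rw [errorGain]; ring_nf
  rcases le_total 0 z with h | h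
  · calc errorGain z ≤ (1 + z) / (1 - z) := by
          rw [h5, div_le_div_iff₀ (by positivity) h3]
          nlinarith [mul_nonneg h h, mul_nonneg h h3.le, mul_nonneg (mul_nonneg h h) h3.le]
      _ ≤ _ := e1 ▸ Real.exp_le_exp.2 (le_abs_self _)
  · have h' : 0 ≤ -z := by linarith
    calc errorGain z ≤ (1 - z) / (1 + z) := by
          rw [h5, div_le_div_iff₀ (by positivity) h4]
          nlinarith [mul_nonneg h' h', mul_nonneg h' h4.le, mul_nonneg (mul_nonneg h' h') h4.le]
      _ ≤ _ := e2 ▸ Real.exp_le_exp.2 (neg_le_abs _)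

/-! ### Iterated first-order filters -/

/-- The operator `(d/dt + lam) ^ j` on sequences of successive derivatives. -/
def filteredSeq (lam : ℝ) (z : ℕ → ℝ) : ℕ → ℕ → ℝ
  | 0, k => z k
  | j + 1, k => filteredSeq lam z j (k + 1) + lam * filteredSeq lam z j k

/-- Pascal's rule. It identifies the binomial form of `zbar` with a cascade that can be undone one
factor at a time. -/
theorem filteredSeq_eq_sum (lam : ℝ) (z : ℕ → ℝ) (j k : ℕ) :
    filteredSeq lam z j k =
      ∑ l ∈ Finset.range (j + 1), (j.choose l : ℝ) * lam ^ l * z (k + (j - l)) := by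
  induction j generalizing k with
  | zero => simp [filteredSeq]
  | succ j ih =>
    rw [filteredSeq, ih, ih, Finset.sum_range_succ' _ (j + 1)]
    have e1 : ∀ l ∈ Finset.range (j + 1),
        ((j + 1).choose (l + 1) : ℝ) * lam ^ (l + 1) * z (k + (j + 1 - (l + 1))) =
        (j.choose l : ℝ) * lam ^ (l + 1) * z (k + (j - l)) +
          (j.choose (l + 1) : ℝ) * lam ^ (l + 1) * z (k + (j - l)) := fun l _ => by
      rw [Nat.choose_succ_succ, Nat.add_sub_add_right]; push_cast; ring
    rw [Finset.sum_congr rfl e1, Finset.sum_add_distrib, Finset.mul_sum,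
      Finset.sum_range_succ (fun l => (j.choose (l + 1) : ℝ) * lam ^ (l + 1) * z (k + (j - l))),
      Finset.sum_range_succ' (fun l => (j.choose l : ℝ) * lam ^ l * z (k + 1 + (j - l)))]
    have e2 : ∀ l ∈ Finset.range j,
        (j.choose (l + 1) : ℝ) * lam ^ (l + 1) * z (k + 1 + (j - (l + 1))) =
        (j.choose (l + 1) : ℝ) * lam ^ (l + 1) * z (k + (j - l)) := fun l hl => by
      rw [show k + 1 + (j - (l + 1)) = k + (j - l) by have := Finset.mem_range.1 hl; omega]
    have e3 : ∀ l ∈ Finset.range (j + 1),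
        lam * ((j.choose l : ℝ) * lam ^ l * z (k + (j - l))) =
        (j.choose l : ℝ) * lam ^ (l + 1) * z (k + (j - l)) := fun l _ => by ring
    rw [Finset.sum_congr rfl e2, Finset.sum_congr rfl e3]
    simp only [Nat.choose_zero_right, Nat.choose_succ_self, Nat.sub_zero, pow_zero, Nat.cast_one,
      Nat.cast_zero, zero_mul, one_mul, show k + 1 + j = k + (j + 1) by omega]
    ring

/-! ### The closed loop as a first-order system, and its arcs -/

namespace FilterNetwork
variable {N n : ℕ} (F : FilterNetwork N n)

/-- The standing assumptions on the network and its exogenous signals. -/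
structure IsAdmissible : Prop where
  one_le : 1 ≤ n
  a_nonneg : ∀ i j, 0 ≤ F.a i j
  b_eq : ∀ i, F.b i = 0 ∨ F.b i = 1
  lam_pos : 0 < F.lam
  c_pos : ∀ i, 0 < F.c i
  rho : ∀ i, IsPerformanceFunction n (F.rho i)
  y0 : HasBoundedPiecewiseDerivs n F.y0
  tree : F.HasLeaderRootedSpanningTree

/-- The closed loop as a system of first-order equations for the filter states. -/
def vectorField (t : ℝ) (X : Fin N → Fin n → ℝ) : Fin N → Fin n → ℝ := fun i k =>
  if h : (k : ℕ) + 1 < n then X i ⟨k + 1, h⟩ else F.nu t X i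

/-- The derivatives of the neighbourhood error of order `0, …, n` along the closed loop. -/
def errorSeq (t : ℝ) (X : Fin N → Fin n → ℝ) (i : Fin N) (k : ℕ) : ℝ :=
  if h : k < n then F.consensusError t X i ⟨k, h⟩ else
    ∑ j, F.a i j * (F.nu t X i - F.nu t X j) +
      F.b i * (F.nu t X i - iteratedDerivWithin n F.y0 (Ici 0) t)

/-- The `k`-th derivative of `(d/dt + lam) ^ j` applied to the neighbourhood error. -/
def filteredError (j k : ℕ) (t : ℝ) (X : Fin N → Fin n → ℝ) (i : Fin N) : ℝ :=
  filteredSeq F.lam (F.errorSeq t X i) j k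

theorem zbar_eq_filteredError (hn : 1 ≤ n) (t : ℝ) (X : Fin N → Fin n → ℝ) (i : Fin N) :
    F.zbar t X i = F.filteredError (n - 1) 0 t X i := by
  rw [filteredError, filteredSeq_eq_sum, Nat.sub_add_cancel hn,
    ← Fin.sum_univ_eq_sum_range (fun l => ((n - 1).choose l : ℝ) * F.lam ^ l *
      F.errorSeq t X i (0 + (n - 1 - l))), zbar]
  refine Finset.sum_congr rfl fun k _ => ?_
  have h : 0 + (n - 1 - (k : ℕ)) < n := by omega
  rw [errorSeq, dif_pos h]
  congr 2
  ext
  rw [Fin.val_rev]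
  simp only
  omega

theorem consensusError_eq_mulVec (t : ℝ) (X : Fin N → Fin n → ℝ) (i : Fin N) (k : Fin n) :
    F.consensusError t X i k = F.followerMatrix.mulVec (fun j => F.delta t X j k) i := by
  rw [followerMatrix_mulVec, consensusError]
  simp only [delta, sub_sub_sub_cancel_right]

theorem delta_eq_mulVec (hF : F.IsAdmissible) (t : ℝ) (X : Fin N → Fin n → ℝ) (i : Fin N)
    (k : Fin n) : F.delta t X i k =
      F.followerMatrix⁻¹.mulVec (fun j => F.consensusError t X j k) i := by
  have hu := (Matrix.isUnit_iff_isUnit_det _).1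
    (isUnit_followerMatrix hF.a_nonneg hF.b_eq hF.tree)
  rw [funext fun j => F.consensusError_eq_mulVec t X j k]
  rw [Matrix.mulVec_mulVec, Matrix.nonsing_inv_mul _ hu, Matrix.one_mulVec]

variable {F}

theorem IsAdmissible.rho_pos (hF : F.IsAdmissible) (i : Fin N) {t : ℝ} (ht : 0 ≤ t) :
    0 < F.rho i t := (hF.rho i).pos t ht

theorem IsAdmissible.rho_le (hF : F.IsAdmissible) (i : Fin N) {t : ℝ} (ht : 0 ≤ t) :
    F.rho i t ≤ F.rho i 0 := (hF.rho i).antitone (mem_Ici.2 le_rfl) ht ht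

theorem IsAdmissible.exists_le_rho (hF : F.IsAdmissible) :
    ∃ r : ℝ, 0 < r ∧ ∀ i, ∀ t, 0 ≤ t → r ≤ F.rho i t := by
  choose l hl hlim using fun i => (hF.rho i).limit
  obtain ⟨r, hr, hle⟩ := exists_pos_forall_le_of_pos hl
  refine ⟨r, hr, fun i t ht => (hle i).trans (le_of_tendsto (hlim i) ?_)⟩
  filter_upwards [eventually_ge_atTop t] with s hs
  exact (hF.rho i).antitone ht (ht.trans hs) hs

theorem IsAdmissible.continuousOn_rho (hF : F.IsAdmissible) (i : Fin N) :
    ContinuousOn (F.rho i) (Ici 0) := (hF.rho i).derivs.contDiffOn.continuousOn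

theorem IsAdmissible.continuousOn_y0 (hF : F.IsAdmissible) (k : Fin n) :
    ContinuousOn (iteratedDerivWithin k F.y0 (Ici 0)) (Ici 0) :=
  hF.y0.continuousOn_iteratedDerivWithin k.2

variable {D : Set ℝ} {X : ℝ → Fin N → Fin n → ℝ}

theorem IsAdmissible.continuousOn_consensusError (hF : F.IsAdmissible) (hD : D ⊆ Ici 0)
    (hX : ContinuousOn X D) (i : Fin N) (k : Fin n) :
    ContinuousOn (fun t => F.consensusError t (X t) i k) D := by
  have h := (hF.continuousOn_y0 k).mono hD
  unfold consensusError
  fun_prop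

theorem IsAdmissible.continuousOn_zbar (hF : F.IsAdmissible) (hD : D ⊆ Ici 0)
    (hX : ContinuousOn X D) (i : Fin N) : ContinuousOn (fun t => F.zbar t (X t) i) D :=
  continuousOn_finsetSum _ fun k _ =>
    continuousOn_const.mul (hF.continuousOn_consensusError hD hX i k.rev)

theorem IsAdmissible.continuousOn_zeta (hF : F.IsAdmissible) (hD : D ⊆ Ici 0)
    (hX : ContinuousOn X D) (i : Fin N) : ContinuousOn (fun t => F.zeta t (X t) i) D :=
  (hF.continuousOn_zbar hD hX i).div ((hF.continuousOn_rho i).mono hD)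
    fun _ ht => (hF.rho_pos i (hD ht)).ne'

theorem IsAdmissible.continuousOn_filteredError (hF : F.IsAdmissible) (hD : D ⊆ Ici 0)
    (hX : ContinuousOn X D) (i : Fin N) {j k : ℕ} (hjk : j + k < n) :
    ContinuousOn (fun t => F.filteredError j k t (X t) i) D := by
  induction j generalizing k with
  | zero =>
    have hk : k < n := by omega
    simpa only [filteredError, filteredSeq, errorSeq, dif_pos hk] using
      hF.continuousOn_consensusError hD hX i ⟨k, hk⟩
  | succ j ih =>
    exact (ih (k := k + 1) (by omega)).add (continuousOn_const.mul (ih (k := k) (by omega)))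

theorem continuous_filteredError_state (t : ℝ) (i : Fin N) {j k : ℕ} (hjk : j + k < n) :
    Continuous (fun X => F.filteredError j k t X i) := by
  induction j generalizing k with
  | zero =>
    have hk : k < n := by omega
    simp only [filteredError, filteredSeq, errorSeq, dif_pos hk, consensusError]
    fun_prop
  | succ j ih =>
    exact (ih (k := k + 1) (by omega)).add (continuous_const.mul (ih (k := k) (by omega)))

variable (F)

/-- A piece of trajectory of the closed loop, on `[0, T)`, within the performance bounds. -/
structure Arc where
  T : ℝ
  X : ℝ → Fin N → Fin n → ℝ
  hasDerivWithinAt : ∀ t ∈ Ico 0 T, HasDerivWithinAt X (F.vectorField t (X t)) (Ico 0 T) t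
  zeta_lt : ∀ t ∈ Ico 0 T, ∀ i, |F.zeta t (X t) i| < 1

/-- The arcs with initial states in a box and normalized errors initially away from `±1`. -/
def initialClass (p : ℝ × ℝ) : Set F.Arc :=
  {s | 0 < p.1 ∧ 0 < s.T ∧ (∀ i k, |s.X 0 i k| ≤ p.2) ∧ ∀ i, |F.zeta 0 (s.X 0) i| ≤ 1 - p.1}

/-- The arcs of an initial class together with the times of their domains. -/
def arcPoints (p : ℝ × ℝ) : Set (F.Arc × ℝ) :=
  {x | x.1 ∈ F.initialClass p ∧ 0 ≤ x.2 ∧ x.2 < x.1.T}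

variable {F}

namespace Arc

theorem continuousOn (s : F.Arc) : ContinuousOn s.X (Ico 0 s.T) :=
  fun t ht => (s.hasDerivWithinAt t ht).continuousWithinAt

theorem hasDerivAt (s : F.Arc) {t : ℝ} (ht : t ∈ Ioo 0 s.T) (i : Fin N) (k : Fin n) :
    HasDerivAt (fun t => s.X t i k) (F.vectorField t (s.X t) i k) t :=
  hasDerivAt_pi.1 (hasDerivAt_pi.1 ((s.hasDerivWithinAt t ⟨ht.1.le, ht.2⟩).hasDerivAt
    (Ico_mem_nhds ht.1 ht.2)) i) k

theorem exists_initial_bound {φ : (Fin N → Fin n → ℝ) → ℝ} (hφ : Continuous φ) (p : ℝ × ℝ) :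
    ∃ K, ∀ s ∈ F.initialClass p, φ (s.X 0) ≤ K := by
  have hc : IsCompact (Icc (fun _ _ => -p.2 : Fin N → Fin n → ℝ) (fun _ _ => p.2)) :=
    isCompact_Icc
  obtain ⟨K, hK⟩ := hc.exists_bound_of_continuousOn hφ.continuousOn
  exact ⟨K, fun s hs => (le_abs_self _).trans (hK _
    ⟨fun i k => (abs_le.1 (hs.2.2.1 i k)).1, fun i k => (abs_le.1 (hs.2.2.1 i k)).2⟩)⟩

theorem mem_arcPoints (p : ℝ × ℝ) (s : F.Arc) (t : ℝ) :
    (s, t) ∈ F.arcPoints p ↔ s ∈ F.initialClass p ∧ 0 ≤ t ∧ t < s.T := Iff.rfl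

/-- Off a locally finite set of times, the filtered errors and the performance functions are
differentiable along all arcs. -/
theorem exists_exceptional_set (hF : F.IsAdmissible) :
    ∃ D : Set ℝ, (∀ t, (D ∩ Icc 0 t).Finite) ∧
      (∀ (s : F.Arc), ∀ t ∈ Ioo 0 s.T, t ∉ D → ∀ i j k, j + k < n →
        HasDerivAt (fun t => F.filteredError j k t (s.X t) i)
          (F.filteredError j (k + 1) t (s.X t) i) t) ∧
      ∀ t, 0 < t → t ∉ D → ∀ i,
        HasDerivAt (F.rho i) (iteratedDerivWithin 1 (F.rho i) (Ici 0) t) t := by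
  -- The exceptional times come from `y0` and the `ρ_i` alone, so one set serves all arcs.
  obtain ⟨D0, hD0, h0⟩ := hF.y0.exists_hasDerivAt
  choose D1 hD1 h1 using fun i => (hF.rho i).derivs.exists_hasDerivAt
  refine ⟨D0 ∪ ⋃ i, D1 i, fun t => ?_, fun s t ht htD i j k hjk => ?_, fun t ht htD i => ?_⟩
  · rw [union_inter_distrib_right, iUnion_inter]
    exact (hD0 t).union (finite_iUnion fun i => hD1 i t)
  · induction j generalizing k with
    | zero =>
      have hk : k < n := by omega
      have hy := h0 t ht.1 (fun h => htD (Or.inl h)) k hk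
      have hX := fun l => s.hasDerivAt ht l ⟨k, hk⟩
      have hd : HasDerivAt (fun t => F.consensusError t (s.X t) i ⟨k, hk⟩)
          (∑ j, F.a i j * (F.vectorField t (s.X t) i ⟨k, hk⟩ -
            F.vectorField t (s.X t) j ⟨k, hk⟩) + F.b i * (F.vectorField t (s.X t) i ⟨k, hk⟩ -
            iteratedDerivWithin (k + 1) F.y0 (Ici 0) t)) t :=
        (HasDerivAt.fun_sum fun j _ => ((hX i).sub (hX j)).const_mul (F.a i j)).add
          (((hX i).sub hy).const_mul (F.b i))
      simp only [filteredError, filteredSeq, errorSeq, dif_pos hk]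
      refine hd.congr_deriv ?_
      by_cases h : k + 1 < n
      · simp only [vectorField, dif_pos h, consensusError]
      · simp only [vectorField, dif_neg h]
        rw [show k + 1 = n by omega]
    | succ j ih =>
      exact (ih (k + 1) (by omega)).add ((ih k (by omega)).const_mul F.lam)
  · have h := h1 i t ht (fun h => htD (Or.inr (mem_iUnion.2 ⟨i, h⟩))) 0 hF.one_le
    rwa [iteratedDerivWithin_zero] at h

end Arc
end FilterNetwork

/-! ### Uniform bounds along arcs -/

namespace FilterNetwork
variable {N n : ℕ} {F : FilterNetwork N n}
namespace Arc

/-- The start of the cascade: this bound is the same for all arcs and requires nothing about the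
inputs. -/
theorem abs_zbar_le (hF : F.IsAdmissible) (s : F.Arc) {t : ℝ} (ht : t ∈ Ico 0 s.T) (i : Fin N) :
    |F.zbar t (s.X t) i| ≤ F.rho i 0 := by
  have h := (s.zeta_lt t ht i).le
  rw [zeta, abs_div, abs_of_pos (hF.rho_pos i ht.1), div_le_one (hF.rho_pos i ht.1)] at h
  exact h.trans (hF.rho_le i ht.1)

/-- The filtered errors are bounded, because they are obtained from `zbar` by stable first-order
filters. -/
theorem ultimatelyBounded_filteredError (hF : F.IsAdmissible) (i : Fin N) {j k : ℕ}
    (hjk : j + k < n) :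
    UltimatelyBounded F.arcPoints (fun x => F.filteredError j k x.2 (x.1.X x.2) i) := by
  obtain ⟨D, hD, hderiv, -⟩ := exists_exceptional_set hF
  -- Write `f_j = (d/dt + λ)^j z_i`. The induction descends from `f_(n-1) = zbar_i`, with `m = n - 1
  -- - j` counting the derivatives of `f_j` that do not involve the inputs.
  suffices h : ∀ m j, j + m = n - 1 → ∀ k ≤ m,
      UltimatelyBounded F.arcPoints (fun x => F.filteredError j k x.2 (x.1.X x.2) i) from
    h (n - 1 - j) j (by omega) k (by omega)
  intro m
  induction m with
  | zero =>
    rintro j hj k hk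
    obtain rfl : k = 0 := by omega
    obtain rfl : j = n - 1 := by omega
    simp only [← zbar_eq_filteredError F hF.one_le]
    exact .of_abs_le _ fun p x hx => abs_zbar_le hF x.1 hx.2 i
  | succ m ihm =>
    intro j hj k
    have hlam := hF.lam_pos
    have hnext := fun k hk => ihm (j + 1) (by omega) k hk
    induction k with
    | zero =>
      intro _
      -- From `f_j' = f_(j+1) - λ f_j` and Young's inequality, `(f_j²)' ≤ -λ f_j² + f_(j+1)² / λ`.
      have hsq : UltimatelyBounded F.arcPoints
          (fun x => F.filteredError j 0 x.2 (x.1.X x.2) i ^ 2) := by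
        refine .of_deriv_le (T := Arc.T) (E := fun x =>
            1 / F.lam * F.filteredError (j + 1) 0 x.2 (x.1.X x.2) i ^ 2)
          mem_arcPoints hlam (((hnext 0 (by omega)).pow 2).const_mul _)
          (fun _ _ _ => sq_nonneg _) (fun s => ?_) hD (fun s t ht htD => ?_) (fun p => ?_)
        · exact (hF.continuousOn_filteredError (fun t ht => ht.1) s.continuousOn i
            (by omega)).pow 2
        · refine ⟨_, (hderiv s t ht htD i j 0 (by omega)).pow 2, ?_⟩
          have e : F.filteredError (j + 1) 0 t (s.X t) i = F.filteredError j (0 + 1) t (s.X t) i +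
            F.lam * F.filteredError j 0 t (s.X t) i := rfl
          simp only [e]
          set f := F.filteredError j 0 t (s.X t) i
          set g := F.filteredError j (0 + 1) t (s.X t) i
          have h2 : 1 / F.lam * (g + F.lam * f) ^ 2 =
            1 / F.lam * g ^ 2 + 2 * f * g + F.lam * f ^ 2 := by field_simp; ring
          have h3 : 0 ≤ 1 / F.lam * g ^ 2 := by positivity
          rw [h2]
          norm_num
          norm_num at h3
          linarith
        · exact exists_initial_bound ((continuous_filteredError_state 0 i (by omega)).pow 2) p
      refine hsq.of_le_monotone (φ := fun r => 1 + r) (fun a b h => by simpa using h)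
        fun p x _ => ?_
      rw [abs_pow]
      nlinarith [sq_nonneg (|F.filteredError j 0 x.2 (x.1.X x.2) i| - 1)]
    | succ k ihk =>
      intro hk
      -- Higher derivatives need no comparison argument: `f_j^(k+1) = f_(j+1)^(k) - λ f_j^(k)`.
      refine ((hnext k (by omega)).sub ((ihk (by omega)).const_mul F.lam)).congr_on
        fun p x _ => ?_
      have e : F.filteredError (j + 1) k x.2 (x.1.X x.2) i =
        F.filteredError j (k + 1) x.2 (x.1.X x.2) i +
          F.lam * F.filteredError j k x.2 (x.1.X x.2) i := rfl
      rw [e]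
      ring

theorem ultimatelyBounded_consensusError (hF : F.IsAdmissible) (i : Fin N) (k : Fin n) :
    UltimatelyBounded F.arcPoints (fun x => F.consensusError x.2 (x.1.X x.2) i k) := by
  have h := ultimatelyBounded_filteredError hF i (j := 0) (k := k) (by omega)
  simpa only [filteredError, filteredSeq, errorSeq, dif_pos k.2] using h

/-- Each factor `d/dt + λ` adds `λ` times a filtered error of total order below `n`, already
bounded. The case `j + k = n` matters: both terms then contain the inputs, not yet known to be
bounded, but their difference does not. -/
theorem ultimatelyBounded_filteredError_sub (hF : F.IsAdmissible) (i : Fin N) {j k : ℕ}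
    (hjk : j + k ≤ n) :
    UltimatelyBounded F.arcPoints (fun x => F.filteredError j k x.2 (x.1.X x.2) i -
      F.errorSeq x.2 (x.1.X x.2) i (j + k)) := by
  induction j generalizing k with
  | zero =>
    refine (UltimatelyBounded.const 0).congr_on fun p x _ => ?_
    rw [zero_add, sub_eq_zero]
    rfl
  | succ j ih =>
    refine ((ih (k := k + 1) (by omega)).add ((ultimatelyBounded_filteredError hF i (j := j)
      (k := k) (by omega)).const_mul F.lam)).congr_on fun p x _ => ?_
    have e : F.filteredError (j + 1) k x.2 (x.1.X x.2) i =
      F.filteredError j (k + 1) x.2 (x.1.X x.2) i +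
        F.lam * F.filteredError j k x.2 (x.1.X x.2) i := rfl
    rw [e, show j + 1 + k = j + (k + 1) by omega]
    ring

theorem ultimatelyBounded_delta (hF : F.IsAdmissible) (i : Fin N) (k : Fin n) :
    UltimatelyBounded F.arcPoints (fun x => F.delta x.2 (x.1.X x.2) i k) := by
  simp only [delta_eq_mulVec F hF, Matrix.mulVec, dotProduct]
  exact .sum fun j _ => (ultimatelyBounded_consensusError hF j k).const_mul _

theorem ultimatelyBounded_state (hF : F.IsAdmissible) (i : Fin N) (k : Fin n) :
    UltimatelyBounded F.arcPoints (fun x => x.1.X x.2 i k) := by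
  obtain ⟨C, hC⟩ := hF.y0.bounded k k.2.le
  exact ((ultimatelyBounded_delta hF i k).add (g := fun x => iteratedDerivWithin k F.y0 (Ici 0) x.2)
    (.of_abs_le C fun p x hx => hC x.2 hx.2.1)).congr_on fun p x _ => by simp [delta]

/-- The part of the derivative of `zeta` that is not due to the inputs is bounded. -/
theorem exists_hasDerivAt_zeta (hF : F.IsAdmissible) :
    ∃ D : Set ℝ, (∀ t, (D ∩ Icc 0 t).Finite) ∧ ∃ e : Fin N → F.Arc × ℝ → ℝ,
      (∀ i, UltimatelyBounded F.arcPoints (e i)) ∧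
      ∀ (s : F.Arc), ∀ t ∈ Ioo 0 s.T, t ∉ D → ∀ i,
        HasDerivAt (fun t => F.zeta t (s.X t) i)
          ((F.followerMatrix.mulVec (F.nu t (s.X t)) i + e i (s, t)) / F.rho i t) t := by
  obtain ⟨D, hD, hderiv, hrho⟩ := exists_exceptional_set hF
  have hn := hF.one_le
  obtain ⟨C0, hC0⟩ := hF.y0.bounded n le_rfl
  choose C hC using fun i => (hF.rho i).derivs.bounded 1 hn
  -- The remainder collects the lower-order terms of `zbar_i'`, the leader term `-b_i y0^(n)`, and
  -- `-ζ_i ρ_i'` from the quotient rule.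
  refine ⟨D, hD, fun i x =>
    (F.filteredError (n - 1) 1 x.2 (x.1.X x.2) i - F.errorSeq x.2 (x.1.X x.2) i (n - 1 + 1)) -
    F.b i * iteratedDerivWithin n F.y0 (Ici 0) x.2 -
    F.zeta x.2 (x.1.X x.2) i * iteratedDerivWithin 1 (F.rho i) (Ici 0) x.2, fun i => ?_,
    fun s t ht htD i => ?_⟩
  · have h1 := ultimatelyBounded_filteredError_sub hF i (j := n - 1) (k := 1) (by omega)
    have h2 : UltimatelyBounded F.arcPoints (fun x => iteratedDerivWithin n F.y0 (Ici 0) x.2) :=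
      .of_abs_le C0 fun p x hx => hC0 x.2 hx.2.1
    have h3 : UltimatelyBounded F.arcPoints (fun x => F.zeta x.2 (x.1.X x.2) i) :=
      .of_abs_le 1 fun p x hx => (x.1.zeta_lt x.2 hx.2 i).le
    have h4 : UltimatelyBounded F.arcPoints
        (fun x => iteratedDerivWithin 1 (F.rho i) (Ici 0) x.2) :=
      .of_abs_le (C i) fun p x hx => hC i x.2 hx.2.1
    exact (h1.sub (h2.const_mul _)).sub (h3.mul h4)
  · have hz := hderiv s t ht htD i (n - 1) 0 (by omega)
    simp only [← zbar_eq_filteredError F hn] at hz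
    have hr := hF.rho_pos i ht.1.le
    refine (hz.div (hrho t ht.1 htD i) hr.ne').congr_deriv ?_
    have e : F.errorSeq t (s.X t) i (n - 1 + 1) =
        F.followerMatrix.mulVec (F.nu t (s.X t)) i -
          F.b i * iteratedDerivWithin n F.y0 (Ici 0) t := by
      rw [Nat.sub_add_cancel hn, errorSeq, dif_neg (lt_irrefl n), followerMatrix_mulVec]
      ring
    simp only [e, zeta, zero_add]
    field_simp
    ring

/-- The Lyapunov step, with `V = ∑ p_i c_i O_i² / 2`. The weights `c_i` make `V'` a form in `ν`
alone, to which the diagonal weight applies and gives `-2κ |ν|²`. Young's inequality spends half of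
this on the terms `p_i ν_i e_i`; the other half is at most `-κ σ V`. -/
theorem ultimatelyBounded_errorTransform (hF : F.IsAdmissible) (i : Fin N) :
    UltimatelyBounded F.arcPoints (fun x => errorTransform (F.zeta x.2 (x.1.X x.2) i)) := by
  obtain ⟨D, hD, e, he, hderiv⟩ := exists_hasDerivAt_zeta hF
  obtain ⟨p, κ, hp, hκ, hform⟩ :=
    exists_diagonal_weight_followerMatrix hF.a_nonneg hF.b_eq hF.tree
  have hcp := hF.c_pos
  -- Since `M_i ≥ 1` and `ρ_i ≤ ρ_i(0)`, one has `|ν_i| ≥ (c_i / ρ_i(0)) |O_i|`; this `σ` converts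
  -- it into `σ V ≤ |ν|²`.
  obtain ⟨σ, hσ, hσle⟩ := exists_pos_forall_le_of_pos
    (f := fun i => (F.c i / F.rho i 0) ^ 2 / (p i * F.c i / 2)) (fun i => by
      have := hF.rho_pos i le_rfl; have := hcp i; have := hp i; positivity)
  have hV : UltimatelyBounded F.arcPoints (fun x =>
      ∑ i, p i * F.c i / 2 * errorTransform (F.zeta x.2 (x.1.X x.2) i) ^ 2) := by
    refine .of_deriv_le (T := Arc.T) (β := κ * σ) (E := fun x => ∑ i, (p i ^ 2 / κ) * e i x ^ 2)
      mem_arcPoints (by positivity) (.sum fun i _ => ((he i).pow 2).const_mul _)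
      (fun _ x _ => Finset.sum_nonneg fun i _ => ?_) (fun s => ?_) hD (fun s t ht htD => ?_)
      (fun q => ?_)
    · have := hcp i; have := hp i; positivity
    · refine continuousOn_finsetSum _ fun i _ => continuousOn_const.mul (ContinuousOn.pow ?_ 2)
      intro t ht
      exact (hasDerivAt_errorTransform (s.zeta_lt t ht i)).continuousAt.comp_continuousWithinAt
        (f := fun t => F.zeta t (s.X t) i)
        (hF.continuousOn_zeta (fun t ht => ht.1) s.continuousOn i t ht)
    · have hζ := s.zeta_lt t ⟨ht.1.le, ht.2⟩
      refine ⟨_, HasDerivAt.fun_sum fun i _ => (((hasDerivAt_errorTransform (hζ i)).comp t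
        (hderiv s t ht htD i)).pow 2).const_mul (p i * F.c i / 2), ?_⟩
      set O : Fin N → ℝ := fun i => errorTransform (F.zeta t (s.X t) i) with hO
      set u : Fin N → ℝ := F.nu t (s.X t) with hu
      have hui : ∀ i, u i = -(F.c i / F.rho i t) * (errorGain (F.zeta t (s.X t) i) * O i) :=
        fun i => rfl
      have hVu : σ * ∑ i, p i * F.c i / 2 * O i ^ 2 ≤ ∑ i, u i ^ 2 := by
        rw [Finset.mul_sum]
        refine Finset.sum_le_sum fun i _ => ?_
        have hr := hF.rho_pos i ht.1.le
        have hr0 := hF.rho_pos i le_rfl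
        have hci := hcp i
        have hpi := hp i
        have h1 : σ * (p i * F.c i / 2) ≤ (F.c i / F.rho i 0) ^ 2 :=
          (le_div_iff₀ (by positivity)).1 (hσle i)
        have h2 : F.c i / F.rho i 0 ≤ F.c i / F.rho i t * errorGain (F.zeta t (s.X t) i) :=
          (div_le_div_of_nonneg_left hci.le hr (hF.rho_le i ht.1.le)).trans
            (le_mul_of_one_le_right (by positivity) (one_le_errorGain (hζ i)))
        have h3 : (F.c i / F.rho i 0) ^ 2 ≤
            (F.c i / F.rho i t * errorGain (F.zeta t (s.X t) i)) ^ 2 :=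
          pow_le_pow_left₀ (by positivity) h2 2
        calc σ * (p i * F.c i / 2 * O i ^ 2) = σ * (p i * F.c i / 2) * O i ^ 2 := by ring
          _ ≤ (F.c i / F.rho i t * errorGain (F.zeta t (s.X t) i)) ^ 2 * O i ^ 2 :=
            mul_le_mul_of_nonneg_right (h1.trans h3) (sq_nonneg _)
          _ = u i ^ 2 := by rw [hui]; ring
      have hsum : ∑ i, p i * F.c i / 2 * (2 * O i ^ (2 - 1) *
          (2 * errorGain (F.zeta t (s.X t) i) *
            ((F.followerMatrix.mulVec u i + e i (s, t)) / F.rho i t))) =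
          -2 * ∑ i, p i * u i * F.followerMatrix.mulVec u i - ∑ i, 2 * (p i * u i * e i (s, t)) := by
        rw [Finset.mul_sum, ← Finset.sum_sub_distrib]
        refine Finset.sum_congr rfl fun i _ => ?_
        have hr := (hF.rho_pos i ht.1.le).ne'
        generalize F.followerMatrix.mulVec u i = h
        rw [hui]
        field_simp
        ring
      have hyoung : -(∑ i, 2 * (p i * u i * e i (s, t))) ≤
          κ * ∑ i, u i ^ 2 + ∑ i, (p i ^ 2 / κ) * e i (s, t) ^ 2 := by
        rw [← Finset.sum_neg_distrib, Finset.mul_sum, ← Finset.sum_add_distrib]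
        refine Finset.sum_le_sum fun i _ => ?_
        have h : 0 ≤ 1 / κ * (κ * u i + p i * e i (s, t)) ^ 2 := by positivity
        have h' : 1 / κ * (κ * u i + p i * e i (s, t)) ^ 2 = κ * u i ^ 2 +
          2 * (p i * u i * e i (s, t)) + p i ^ 2 / κ * e i (s, t) ^ 2 := by field_simp; ring
        linarith
      have hκV := mul_le_mul_of_nonneg_left hVu hκ.le
      have hfu := hform u
      refine le_trans (le_of_eq ?_) (?_ : -2 * ∑ i, p i * u i * F.followerMatrix.mulVec u i -
          ∑ i, 2 * (p i * u i * e i (s, t)) ≤ _)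
      · rw [← hsum]; rfl
      · simp only
        rw [neg_mul (κ * σ), mul_assoc κ σ]
        simp only [hO] at hκV
        linarith
    -- Classes with a nonpositive margin are empty. Otherwise `ζ_i(0)` lies in a compact subset of
    -- `(-1, 1)`, on which the transformation is bounded.
    · rcases le_or_gt q.1 0 with hq | hq
      · exact ⟨0, fun s hs => absurd hs.1 (not_lt.2 hq)⟩
      have hcont : ContinuousOn errorTransform (Icc (-(1 - q.1)) (1 - q.1)) := fun z hz =>
        ((hasDerivAt_errorTransform ((abs_le.2 hz).trans_lt
          (by linarith))).continuousAt).continuousWithinAt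
      obtain ⟨K, hK⟩ := isCompact_Icc.exists_bound_of_continuousOn hcont
      refine ⟨∑ i, p i * F.c i / 2 * K ^ 2, fun s hs => Finset.sum_le_sum fun i _ => ?_⟩
      refine mul_le_mul_of_nonneg_left ?_ (by have := hcp i; have := hp i; positivity)
      rw [← sq_abs]
      exact pow_le_pow_left₀ (abs_nonneg _) (hK _ (abs_le.1 (hs.2.2.2 i))) 2
  refine hV.of_le_monotone (φ := fun r => 1 + r / (p i * F.c i / 2)) (fun a b h => ?_)
    fun q x _ => ?_
  · have := hcp i; have := hp i
    simp only
    gcongr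
  · have hw : 0 < p i * F.c i / 2 := by have := hcp i; have := hp i; positivity
    have hle : p i * F.c i / 2 * errorTransform (F.zeta x.2 (x.1.X x.2) i) ^ 2 ≤
        |∑ i, p i * F.c i / 2 * errorTransform (F.zeta x.2 (x.1.X x.2) i) ^ 2| :=
      (Finset.single_le_sum (f := fun i => p i * F.c i / 2 *
        errorTransform (F.zeta x.2 (x.1.X x.2) i) ^ 2) (fun j _ => by
          have := hcp j; have := hp j; positivity) (Finset.mem_univ i)).trans (le_abs_self _)
    rw [mul_comm, ← le_div_iff₀ hw, ← sq_abs] at hle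
    nlinarith [sq_nonneg (|errorTransform (F.zeta x.2 (x.1.X x.2) i)| - 1)]

theorem ultimatelyBounded_errorGain (hF : F.IsAdmissible) (i : Fin N) :
    UltimatelyBounded F.arcPoints (fun x => errorGain (F.zeta x.2 (x.1.X x.2) i)) :=
  (ultimatelyBounded_errorTransform hF i).of_le_monotone Real.exp_monotone fun p x hx => by
    have h := x.1.zeta_lt x.2 hx.2 i
    rw [abs_of_nonneg (zero_le_one.trans (one_le_errorGain h))]
    exact errorGain_le_exp_abs_errorTransform h

theorem ultimatelyBounded_nu (hF : F.IsAdmissible) (i : Fin N) :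
    UltimatelyBounded F.arcPoints (fun x => F.nu x.2 (x.1.X x.2) i) := by
  obtain ⟨r, hr, hle⟩ := hF.exists_le_rho
  refine .mul (f := fun x => -(F.c i / F.rho i x.2)) (.of_abs_le (F.c i / r) fun p x hx => ?_)
    ((ultimatelyBounded_errorGain hF i).mul (ultimatelyBounded_errorTransform hF i))
  have hrp := hF.rho_pos i hx.2.1
  rw [abs_neg, abs_of_pos (div_pos (hF.c_pos i) hrp)]
  exact div_le_div_of_nonneg_left (hF.c_pos i).le hr (hle i x.2 hx.2.1)

/-- All signals are bounded along arcs of an initial class, and ultimately bounded by a common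
constant. -/
theorem exists_signals_bound (hF : F.IsAdmissible) : ∃ μ : ℝ, ∀ p, ∃ K τ : ℝ,
    ∀ s ∈ F.initialClass p, ∀ t ∈ Ico 0 s.T,
      F.SignalsBoundedBy K t (s.X t) ∧ (τ ≤ t → F.SignalsBoundedBy μ t (s.X t)) := by
  -- All signals are bundled into one vector with the sup norm, so that a single `μ`, `K` and `τ`
  -- serve for all of them.
  have h : UltimatelyBounded F.arcPoints (fun x (i : Fin N) =>
      (x.1.X x.2 i, F.delta x.2 (x.1.X x.2) i, F.consensusError x.2 (x.1.X x.2) i,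
        F.zbar x.2 (x.1.X x.2) i, F.zeta x.2 (x.1.X x.2) i,
        errorTransform (F.zeta x.2 (x.1.X x.2) i), errorGain (F.zeta x.2 (x.1.X x.2) i),
        F.nu x.2 (x.1.X x.2) i)) :=
    .pi fun i => .prodMk (.pi fun k => ultimatelyBounded_state hF i k) <|
      .prodMk (.pi fun k => ultimatelyBounded_delta hF i k) <|
      .prodMk (.pi fun k => ultimatelyBounded_consensusError hF i k) <|
      .prodMk (.of_abs_le _ fun p x hx => abs_zbar_le hF x.1 hx.2 i) <|
      .prodMk (.of_abs_le 1 fun p x hx => (x.1.zeta_lt x.2 hx.2 i).le) <|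
      .prodMk (ultimatelyBounded_errorTransform hF i) <|
      .prodMk (ultimatelyBounded_errorGain hF i) (ultimatelyBounded_nu hF i)
  obtain ⟨μ, hμ⟩ := ultimatelyBounded_iff.1 h
  have key : ∀ (K t : ℝ) (X : Fin N → Fin n → ℝ), ‖fun i => (X i, F.delta t X i,
      F.consensusError t X i, F.zbar t X i, F.zeta t X i, errorTransform (F.zeta t X i),
      errorGain (F.zeta t X i), F.nu t X i)‖ ≤ K → F.SignalsBoundedBy K t X := by
    intro K t X hK i
    have hi := (norm_le_pi_norm _ i).trans hK
    simp only [Prod.norm_mk, sup_le_iff] at hi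
    obtain ⟨h1, h2, h3, h4, h5, h6, h7, h8⟩ := hi
    exact ⟨fun k => (norm_le_pi_norm _ k).trans h1, fun k => (norm_le_pi_norm _ k).trans h2,
      fun k => (norm_le_pi_norm _ k).trans h3, h4, h5, h6, h7, h8⟩
  refine ⟨μ, fun p => ?_⟩
  obtain ⟨K, τ, hK⟩ := hμ p
  exact ⟨K, τ, fun s hs t ht => ⟨key K t _ (hK (s, t) ⟨hs, ht⟩).1,
    fun hτ => key μ t _ ((hK (s, t) ⟨hs, ht⟩).2 hτ)⟩⟩

end Arc
end FilterNetwork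

/-! ### Global solutions of the saturated system -/

open Asymptotics NNReal

/-- A vector field on `[0, ∞)` that is continuous in time, uniformly Lipschitz in space, and
bounded has global forward solutions. -/
theorem exists_global_solution_of_lipschitz_of_bounded {E : Type*} [NormedAddCommGroup E]
    [NormedSpace ℝ E] [CompleteSpace E] {f : ℝ → E → E} {L M : ℝ≥0}
    (hL : ∀ t, 0 ≤ t → LipschitzWith L (f t)) (hM : ∀ t, 0 ≤ t → ∀ x, ‖f t x‖ ≤ M)
    (hc : ∀ x, ContinuousOn (fun t => f t x) (Ici 0)) (x₀ : E) :
    ∃ X : ℝ → E, X 0 = x₀ ∧ ∀ t, 0 ≤ t → HasDerivWithinAt X (f t (X t)) (Ici 0) t := by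
  have hloc : ∀ k : ℕ, ∃ α : ℝ → E, α 0 = x₀ ∧ ∀ t ∈ Icc (0 : ℝ) (k + 1),
      HasDerivWithinAt α (f t (α t)) (Icc 0 (k + 1)) t := fun k => by
    have hk : (0 : ℝ) ≤ k + 1 := by positivity
    -- A ball of radius `M (k + 1)` cannot be left by time `k + 1` at speed at most `M`, so the time
    -- interval need not be small.
    have hP : IsPicardLindelof f (tmin := 0) (tmax := k + 1) ⟨0, le_rfl, hk⟩ x₀
        (M * (k + 1)) 0 M L :=
      { lipschitzOnWith := fun t ht => (hL t ht.1).lipschitzOnWith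
        continuousOn := fun x _ => (hc x).mono fun t ht => ht.1
        norm_le := fun t ht x _ => hM t ht.1 x
        mul_max_le := by simp [hk] }
    exact hP.exists_eq_forall_mem_Icc_hasDerivWithinAt₀
  choose α hα0 hα using hloc
  have hagree : ∀ j k : ℕ, j ≤ k → EqOn (α j) (α k) (Icc 0 (j + 1)) := fun j k hjk => by
    have hjk' : (j : ℝ) + 1 ≤ k + 1 := by exact_mod_cast Nat.succ_le_succ hjk
    have hcont : ∀ k, ContinuousOn (α k) (Icc 0 (k + 1)) := fun k t ht =>
      (hα k t ht).continuousWithinAt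
    have hder : ∀ k : ℕ, ∀ t ∈ Ico (0 : ℝ) (k + 1),
        HasDerivWithinAt (α k) (f t (α k t)) (Ici t) t :=
      fun k t ht => (hα k t ⟨ht.1, ht.2.le⟩).mono_of_mem_nhdsWithin
        (mem_of_superset (Icc_mem_nhdsGE ht.2) (Icc_subset_Icc_left ht.1))
    exact ODE_solution_unique_of_mem_Icc_right (s := fun _ => univ)
      (fun t ht => (hL t ht.1).lipschitzOnWith) (hcont j) (hder j) (fun _ _ => trivial)
      ((hcont k).mono (Icc_subset_Icc_right hjk')) (fun t ht => hder k t
        ⟨ht.1, ht.2.trans_le hjk'⟩) (fun _ _ => trivial) ((hα0 j).trans (hα0 k).symm)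
  -- At `t` the solution on `[0, ⌊t⌋₊ + 1]` is used: its right end lies strictly beyond `t`, so it
  -- also governs a neighbourhood of `t` in `[0, ∞)`.
  refine ⟨fun t => α ⌊t⌋₊ t, by simpa using hα0 0, fun t ht => ?_⟩
  have hlt := Nat.lt_floor_add_one t
  have hd : HasDerivWithinAt (α ⌊t⌋₊) (f t (α ⌊t⌋₊ t)) (Ici 0) t :=
    (hα ⌊t⌋₊ t ⟨ht, hlt.le⟩).mono_of_mem_nhdsWithin (by
      rw [← Ici_inter_Iic]
      exact inter_mem self_mem_nhdsWithin (mem_nhdsWithin_of_mem_nhds (Iic_mem_nhds hlt)))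
  refine hd.congr_of_eventuallyEq ?_ rfl
  filter_upwards [self_mem_nhdsWithin, mem_nhdsWithin_of_mem_nhds (Iio_mem_nhds hlt)] with s hs hst
  have hfl : ⌊s⌋₊ ≤ ⌊t⌋₊ := Nat.lt_succ_iff.1 ((Nat.floor_lt hs).2 (by exact_mod_cast hst))
  exact hagree _ _ hfl ⟨hs, (Nat.lt_floor_add_one s).le⟩

/-- The saturation of a real number at `±r`. -/
def saturate (r x : ℝ) : ℝ := max (-r) (min r x)

theorem saturate_of_abs_le {r x : ℝ} (h : |x| ≤ r) : saturate r x = x := by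
  rw [saturate, min_eq_right (abs_le.1 h).2, max_eq_right (abs_le.1 h).1]

theorem saturate_mem_Icc {r : ℝ} (hr : 0 ≤ r) (x : ℝ) : saturate r x ∈ Icc (-r) r :=
  ⟨le_max_left _ _, max_le (by linarith) (min_le_left _ _)⟩

theorem abs_saturate_sub_le (r x y : ℝ) : |saturate r x - saturate r y| ≤ |x - y| := by
  have h : LipschitzWith 1 (saturate r) := (LipschitzWith.id.const_min r).const_max (-r)
  simpa [Real.dist_eq] using h.dist_le_mul x y

theorem exists_lipschitzOnWith_errorGain_mul_errorTransform {r : ℝ} (hr1 : r < 1) :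
    ∃ K, LipschitzOnWith K (fun z => errorGain z * errorTransform z) (Icc (-r) r) := by
  have h1 : ∀ z ∈ Icc (-r) r, 1 - z ≠ 0 := fun z hz => by linarith [hz.2]
  have h2 : ∀ z ∈ Icc (-r) r, 1 + z ≠ 0 := fun z hz => by linarith [hz.1]
  have h3 : ∀ z ∈ Icc (-r) r, 1 - z ^ 2 ≠ 0 := fun z hz => by
    rw [show 1 - z ^ 2 = (1 - z) * (1 + z) by ring]
    exact mul_ne_zero (h1 z hz) (h2 z hz)
  have hG : ContDiffOn ℝ 1 errorGain (Icc (-r) r) :=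
    contDiffOn_const.div (contDiffOn_const.sub (contDiffOn_id.pow 2)) h3
  have hO : ContDiffOn ℝ 1 errorTransform (Icc (-r) r) :=
    ((contDiffOn_const.add contDiffOn_id).div (contDiffOn_const.sub contDiffOn_id) h1).log
      fun z hz => div_ne_zero (h2 z hz) (h1 z hz)
  exact (hG.mul hO).exists_lipschitzOnWith one_ne_zero (convex_Icc _ _) isCompact_Icc

namespace FilterNetwork
variable {N n : ℕ} {F : FilterNetwork N n}

variable (F) in
/-- The closed-loop vector field with the normalized errors saturated at `r` and the states
saturated at `B`. -/
def saturatedField (r B t : ℝ) (X : Fin N → Fin n → ℝ) : Fin N → Fin n → ℝ := fun i k =>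
  if h : (k : ℕ) + 1 < n then saturate B (X i ⟨k + 1, h⟩) else
    -(F.c i / F.rho i t) * (errorGain (saturate r (F.zeta t X i)) *
      errorTransform (saturate r (F.zeta t X i)))

theorem saturatedField_eq {r B t : ℝ} {X : Fin N → Fin n → ℝ} (hr : ∀ i, |F.zeta t X i| ≤ r)
    (hB : ∀ i k, |X i k| ≤ B) : F.saturatedField r B t X = F.vectorField t X := by
  funext i k
  simp only [saturatedField, vectorField, saturate_of_abs_le (hr i)]
  split_ifs with h
  · exact saturate_of_abs_le (hB _ _)
  · rfl

theorem IsAdmissible.abs_gain_le (hF : F.IsAdmissible) : ∃ C : ℝ, 0 ≤ C ∧ ∀ i t, 0 ≤ t →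
    |F.c i / F.rho i t| ≤ C := by
  obtain ⟨ρ, hρ, hle⟩ := hF.exists_le_rho
  have hc := hF.c_pos
  refine ⟨∑ j, F.c j / ρ, Finset.sum_nonneg fun j _ => (div_pos (hc j) hρ).le, fun i t ht => ?_⟩
  rw [abs_of_pos (div_pos (hc i) (hF.rho_pos i ht))]
  exact (div_le_div_of_nonneg_left (hc i).le hρ (hle i t ht)).trans
    (Finset.single_le_sum (f := fun j => F.c j / ρ) (fun j _ => (div_pos (hc j) hρ).le)
      (Finset.mem_univ i))

theorem saturatedField_norm_le (hF : F.IsAdmissible) {r B : ℝ} (hr0 : 0 ≤ r) (hr1 : r < 1)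
    (hB : 0 ≤ B) : ∃ M : ℝ≥0, ∀ t, 0 ≤ t → ∀ X, ‖F.saturatedField r B t X‖ ≤ M := by
  obtain ⟨C, hC0, hC⟩ := hF.abs_gain_le
  obtain ⟨K, hK⟩ := exists_lipschitzOnWith_errorGain_mul_errorTransform hr1
  obtain ⟨Q, hQ⟩ := isCompact_Icc.exists_bound_of_continuousOn hK.continuousOn
  have hQ0 : 0 ≤ Q := (norm_nonneg _).trans (hQ 0 ⟨by linarith, hr0⟩)
  have hM : 0 ≤ B + C * Q := by positivity
  refine ⟨⟨_, hM⟩, fun t ht X => (pi_norm_le_iff_of_nonneg hM).2 fun i =>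
    (pi_norm_le_iff_of_nonneg hM).2 fun k => ?_⟩
  rw [saturatedField]
  split_ifs with h
  · exact (abs_le.2 (saturate_mem_Icc hB _)).trans (by nlinarith)
  · rw [norm_mul, norm_neg]
    exact (mul_le_mul (hC i t ht) (hQ _ (saturate_mem_Icc hr0 _)) (norm_nonneg _) hC0).trans
      (by linarith)

/-- The leader terms cancel in the difference, which is linear in the states, and `1 / ρ_i` is
bounded. The principal filter makes the Lipschitz constant uniform in `t ≥ 0`. -/
theorem zeta_sub_isBigO (hF : F.IsAdmissible) (i : Fin N) :
    (fun x : ℝ × (Fin N → Fin n → ℝ) × (Fin N → Fin n → ℝ) =>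
      F.zeta x.1 x.2.1 i - F.zeta x.1 x.2.2 i) =O[𝓟 {x | 0 ≤ x.1}] fun x => x.2.1 - x.2.2 := by
  obtain ⟨ρ, hρ, hle⟩ := hF.exists_le_rho
  set l := 𝓟 {x : ℝ × (Fin N → Fin n → ℝ) × (Fin N → Fin n → ℝ) | 0 ≤ x.1}
  have hcoord : ∀ (i : Fin N) (k : Fin n),
      (fun x : ℝ × (Fin N → Fin n → ℝ) × (Fin N → Fin n → ℝ) => x.2.1 i k - x.2.2 i k)
        =O[l] fun x => x.2.1 - x.2.2 := fun i k =>
    isBigO_pi.1 (isBigO_pi.1 (isBigO_refl (fun x : ℝ × (Fin N → Fin n → ℝ) ×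
      (Fin N → Fin n → ℝ) => x.2.1 - x.2.2) l) i) k
  have hcons : ∀ (i : Fin N) (k : Fin n),
      (fun x : ℝ × (Fin N → Fin n → ℝ) × (Fin N → Fin n → ℝ) =>
        F.consensusError x.1 x.2.1 i k - F.consensusError x.1 x.2.2 i k)
        =O[l] fun x => x.2.1 - x.2.2 := fun i k => by
    refine ((IsBigO.fun_sum fun j (_ : j ∈ Finset.univ) =>
      ((hcoord i k).sub (hcoord j k)).const_mul_left (F.a i j)).add
        ((hcoord i k).const_mul_left (F.b i))).congr_left fun x => ?_
    simp only [consensusError]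
    rw [add_sub_add_comm, ← Finset.sum_sub_distrib]
    congr 1
    · exact Finset.sum_congr rfl fun j _ => by ring
    · ring
  have hzbar : (fun x : ℝ × (Fin N → Fin n → ℝ) × (Fin N → Fin n → ℝ) =>
      F.zbar x.1 x.2.1 i - F.zbar x.1 x.2.2 i) =O[l] fun x => x.2.1 - x.2.2 := by
    refine (IsBigO.fun_sum fun (k : Fin n) (_ : k ∈ Finset.univ) =>
      (hcons i k.rev).const_mul_left (((n - 1).choose k : ℝ) * F.lam ^ (k : ℕ))).congr_left
        fun x => ?_
    simp only [zbar, ← Finset.sum_sub_distrib, mul_sub]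
  refine (IsBigO.of_bound (1 / ρ) ?_).trans hzbar
  intro x hx
  have hx' := hF.rho_pos i (show 0 ≤ x.1 from hx)
  have e : F.zeta x.1 x.2.1 i - F.zeta x.1 x.2.2 i =
      (F.rho i x.1)⁻¹ * (F.zbar x.1 x.2.1 i - F.zbar x.1 x.2.2 i) := by
    simp only [zeta]; ring
  change ‖F.zeta x.1 x.2.1 i - F.zeta x.1 x.2.2 i‖ ≤ _
  rw [e, norm_mul, Real.norm_of_nonneg (inv_nonneg.2 hx'.le), one_div]
  exact mul_le_mul_of_nonneg_right (inv_anti₀ hρ (hle i _ hx)) (norm_nonneg _)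

theorem saturatedField_lipschitz (hF : F.IsAdmissible) {r : ℝ} (hr0 : 0 ≤ r) (hr1 : r < 1)
    (B : ℝ) : ∃ L : ℝ≥0, ∀ t, 0 ≤ t → LipschitzWith L (F.saturatedField r B t) := by
  obtain ⟨C, hC0, hC⟩ := hF.abs_gain_le
  obtain ⟨K, hK⟩ := exists_lipschitzOnWith_errorGain_mul_errorTransform hr1
  have h : (fun x : ℝ × (Fin N → Fin n → ℝ) × (Fin N → Fin n → ℝ) =>
      F.saturatedField r B x.1 x.2.1 - F.saturatedField r B x.1 x.2.2)
      =O[𝓟 {x | 0 ≤ x.1}] fun x => x.2.1 - x.2.2 := by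
    refine isBigO_pi.2 fun i => isBigO_pi.2 fun k => ?_
    simp only [Pi.sub_apply, saturatedField]
    split_ifs with h
    · refine (IsBigO.of_bound 1 (Eventually.of_forall fun x => ?_)).trans
        (isBigO_pi.1 (isBigO_pi.1 (isBigO_refl (fun x : ℝ × (Fin N → Fin n → ℝ) ×
          (Fin N → Fin n → ℝ) => x.2.1 - x.2.2) _) i) ⟨k + 1, h⟩)
      rw [one_mul]
      exact abs_saturate_sub_le _ _ _
    · refine (IsBigO.of_bound (C * K) (eventually_principal.2 fun x hx => ?_)).trans
        (zeta_sub_isBigO hF i)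
      rw [← mul_sub, norm_mul, norm_neg, mul_assoc]
      refine mul_le_mul (hC i _ hx) ?_ (norm_nonneg _) hC0
      have hd := hK.dist_le_mul _ (saturate_mem_Icc hr0 (F.zeta x.1 x.2.1 i)) _
        (saturate_mem_Icc hr0 (F.zeta x.1 x.2.2 i))
      exact hd.trans (mul_le_mul_of_nonneg_left (abs_saturate_sub_le _ _ _) K.2)
  obtain ⟨L, hL0, hL⟩ := h.exists_nonneg
  refine ⟨⟨L, hL0⟩, fun t ht => LipschitzWith.of_dist_le_mul fun X Y => ?_⟩
  rw [dist_eq_norm, dist_eq_norm]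
  exact eventually_principal.1 (isBigOWith_iff.1 hL) (t, X, Y) ht

theorem saturatedField_continuousOn (hF : F.IsAdmissible) {r : ℝ} (hr0 : 0 ≤ r) (hr1 : r < 1)
    (B : ℝ) (X : Fin N → Fin n → ℝ) :
    ContinuousOn (fun t => F.saturatedField r B t X) (Ici 0) := by
  obtain ⟨K, hK⟩ := exists_lipschitzOnWith_errorGain_mul_errorTransform hr1
  refine continuousOn_pi.2 fun i => continuousOn_pi.2 fun k => ?_
  simp only [saturatedField]
  split_ifs with h
  · exact continuousOn_const
  · have hsat : Continuous (saturate r) := by unfold saturate; fun_prop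
    exact (continuousOn_const.div (hF.continuousOn_rho i) fun t ht => (hF.rho_pos i ht).ne').neg.mul
      (hK.continuousOn.comp (hsat.comp_continuousOn
        (hF.continuousOn_zeta subset_rfl continuousOn_const i)) fun t _ => saturate_mem_Icc hr0 _)

end FilterNetwork

theorem abs_le_of_forall_Ico {f : ℝ → ℝ} {T t c : ℝ} (hf : ContinuousOn f (Ico 0 T))
    (ht : t ∈ Ico 0 T) (h0 : 0 < t) (h : ∀ s ∈ Ico 0 t, |f s| ≤ c) : |f t| ≤ c := by
  have hne : (𝓝[Ico 0 t] t).NeBot := by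
    rw [← mem_closure_iff_nhdsWithin_neBot, closure_Ico h0.ne]
    exact right_mem_Icc.2 h0.le
  have hc : ContinuousWithinAt f (Ico 0 t) t :=
    (hf t ht).mono (Ico_subset_Ico_right ht.2.le)
  exact le_of_tendsto hc.abs (eventually_mem_nhdsWithin.mono h)

theorem hasDerivWithinAt_Ici_of_Ico {E : Type*} [NormedAddCommGroup E] [NormedSpace ℝ E]
    {f : ℝ → E} {f' : E} {T t : ℝ} (ht : t ∈ Ico 0 T) (h : HasDerivWithinAt f f' (Ico 0 T) t) :
    HasDerivWithinAt f f' (Ici t) t :=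
  h.mono_of_mem_nhdsWithin (mem_of_superset (Ico_mem_nhdsGE ht.2) (Ico_subset_Ico_left ht.1))

/-! ### Invariance of the performance bounds, existence and uniqueness -/

namespace FilterNetwork
variable {N n : ℕ} {F : FilterNetwork N n}

/-- The arcs from a given initial state remain in a compact set within the performance bounds. -/
theorem exists_arc_bound (hF : F.IsAdmissible) {x₀ : Fin N → Fin n → ℝ}
    (hx₀ : ∀ i, |F.zeta 0 x₀ i| < 1) : ∃ r B : ℝ, 0 ≤ r ∧ r < 1 ∧ 0 ≤ B ∧
      ((∀ i, |F.zeta 0 x₀ i| ≤ r) ∧ ∀ i k, |x₀ i k| ≤ B) ∧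
      ∀ s : F.Arc, s.X 0 = x₀ → ∀ t ∈ Ico 0 s.T,
        (∀ i, |F.zeta t (s.X t) i| ≤ r) ∧ ∀ i k, |s.X t i k| ≤ B := by
  obtain ⟨ϱ, hϱ, hϱle⟩ := exists_pos_forall_le_of_pos
    (f := fun i => 1 - |F.zeta 0 x₀ i|) (fun i => by linarith [hx₀ i])
  have hxn : ∀ i k, |x₀ i k| ≤ ‖x₀‖ := fun i k =>
    (norm_le_pi_norm (x₀ i) k).trans (norm_le_pi_norm x₀ i)
  obtain ⟨μ, hμ⟩ := Arc.exists_signals_bound hF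
  obtain ⟨K, τ, hK⟩ := hμ (ϱ, ‖x₀‖)
  -- A bound `M_i ≤ K` means `ζ_i² ≤ 1 - 1 / K`. The maximum with `1` keeps the inverse meaningful
  -- when `K` is not positive.
  set q := max (1 - (max K 1)⁻¹) 0
  have hK1 : 0 < max K 1 := lt_max_of_lt_right one_pos
  have hq0 : 0 ≤ q := le_max_right _ _
  have hq1 : q < 1 := max_lt (by linarith [inv_pos.2 hK1]) one_pos
  have hsq1 : √q < 1 := by rw [Real.sqrt_lt' one_pos]; linarith
  refine ⟨max √q (1 - ϱ), max K ‖x₀‖, le_max_of_le_left (Real.sqrt_nonneg _),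
    max_lt hsq1 (by linarith), le_max_of_le_right (norm_nonneg _),
    ⟨fun i => le_max_of_le_right (by linarith [hϱle i]), fun i k => le_max_of_le_right (hxn i k)⟩,
    fun s hs t ht => ?_⟩
  have hb := (hK s ⟨hϱ, ht.1.trans_lt ht.2, fun i k => by rw [hs]; exact hxn i k, fun i => by
    rw [hs]; simp only; linarith [hϱle i]⟩ t ht).1
  refine ⟨fun i => le_max_of_le_left ?_, fun i k => le_max_of_le_left ((hb i).1 k)⟩
  have hζ := s.zeta_lt t ht i
  have hM : errorGain (F.zeta t (s.X t) i) ≤ max K 1 :=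
    (le_abs_self _).trans ((hb i).2.2.2.2.2.2.1.trans (le_max_left _ _))
  have hpos : 0 < 1 - F.zeta t (s.X t) i ^ 2 := by
    linarith [(sq_lt_one_iff_abs_lt_one (F.zeta t (s.X t) i)).2 hζ]
  rw [errorGain, one_div] at hM
  have hinv : (max K 1)⁻¹ ≤ 1 - F.zeta t (s.X t) i ^ 2 := inv_le_of_inv_le₀ hpos hM
  exact Real.abs_le_sqrt ((by linarith : _ ≤ 1 - (max K 1)⁻¹).trans (le_max_left _ _))

/-- A solution of the closed loop that starts within the performance bounds stays there. -/
theorem abs_zeta_lt_one_of_solution (hF : F.IsAdmissible) {T : ℝ} {X : ℝ → Fin N → Fin n → ℝ}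
    (hX : ∀ t ∈ Ico 0 T, HasDerivWithinAt X (F.vectorField t (X t)) (Ico 0 T) t)
    (h0 : ∀ i, |F.zeta 0 (X 0) i| < 1) : ∀ t ∈ Ico 0 T, ∀ i, |F.zeta t (X t) i| < 1 := by
  obtain ⟨r, B, -, hr1, -, -, harc⟩ := exists_arc_bound hF h0
  have hcont : ∀ i, ContinuousOn (fun t => F.zeta t (X t) i) (Ico 0 T) :=
    hF.continuousOn_zeta (fun t ht => ht.1) fun t ht => (hX t ht).continuousWithinAt
  refine forall_mem_Ico_of_open_of_persists h0 (fun t ht hG => eventually_all.2 fun i =>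
    (hcont i t ht).abs.eventually_lt_const (hG i)) fun t ht ht0 hG i => ?_
  -- The solution restricted to `[0, t)` is an arc; its bound `r < 1` is independent of `t` and
  -- passes to time `t` by continuity.
  refine (abs_le_of_forall_Ico (hcont i) ht ht0 fun s hs => ?_).trans_lt hr1
  exact (harc ⟨t, X, fun s hs => (hX s ⟨hs.1, hs.2.trans ht.2⟩).mono
    (Ico_subset_Ico_right ht.2.le), hG⟩ rfl s hs).1 i

/-- The closed loop has a global solution from each initial state within the performance
bounds. -/
theorem exists_global_solution (hF : F.IsAdmissible) {x₀ : Fin N → Fin n → ℝ}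
    (hx₀ : ∀ i, |F.zeta 0 x₀ i| < 1) : ∃ X : ℝ → Fin N → Fin n → ℝ, X 0 = x₀ ∧
      ∀ t, 0 ≤ t → HasDerivWithinAt X (F.vectorField t (X t)) (Ici 0) t := by
  obtain ⟨r', B', hr0, hr1', hB0, ⟨hinit, hinitB⟩, harc⟩ := exists_arc_bound hF hx₀
  -- The saturation levels lie strictly beyond the a priori bounds `r'` and `B'`. Being strictly
  -- unsaturated is then an open condition, and while it lasts the trajectory is an arc, so the
  -- bounds restore the margin.
  obtain ⟨r, hrr, hr1⟩ := exists_between hr1'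
  set B := B' + 1
  have hBB : B' < B := lt_add_one B'
  obtain ⟨L, hL⟩ := saturatedField_lipschitz hF (hr0.trans hrr.le) hr1 B
  obtain ⟨M, hM⟩ := saturatedField_norm_le hF (hr0.trans hrr.le) hr1 (hB0.trans hBB.le)
  obtain ⟨X, hX0, hX⟩ := exists_global_solution_of_lipschitz_of_bounded hL hM
    (saturatedField_continuousOn hF (hr0.trans hrr.le) hr1 B) x₀
  have hXc : ContinuousOn X (Ici 0) := fun t ht => (hX t ht).continuousWithinAt
  have hsub : ∀ T : ℝ, Ico 0 T ⊆ Ici 0 := fun T t ht => ht.1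
  have hζc : ∀ i, ContinuousOn (fun t => F.zeta t (X t) i) (Ici 0) :=
    hF.continuousOn_zeta subset_rfl hXc
  have hXic : ∀ i k, ContinuousOn (fun t => X t i k) (Ici 0) := fun i k => by fun_prop
  have hfield : ∀ t, (∀ i, |F.zeta t (X t) i| < r) ∧ (∀ i k, |X t i k| < B) →
      F.saturatedField r B t (X t) = F.vectorField t (X t) := fun t h =>
    saturatedField_eq (fun i => (h.1 i).le) fun i k => (h.2 i k).le
  have hin : ∀ T : ℝ, ∀ t ∈ Ico 0 T, (∀ i, |F.zeta t (X t) i| < r) ∧ ∀ i k, |X t i k| < B := by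
    intro T
    refine forall_mem_Ico_of_open_of_persists
      ⟨fun i => by rw [hX0]; exact (hinit i).trans_lt hrr,
        fun i k => by rw [hX0]; exact (hinitB i k).trans_lt hBB⟩ (fun t ht hG => ?_)
      fun t ht ht0 hG => ?_
    · exact (eventually_all.2 fun i =>
        (((hζc i).mono (hsub T)) t ht).abs.eventually_lt_const (hG.1 i)).and
        (eventually_all.2 fun i => eventually_all.2 fun k =>
          (((hXic i k).mono (hsub T)) t ht).abs.eventually_lt_const (hG.2 i k))
    · have hb := harc ⟨t, X, fun s hs => by
        rw [← hfield s (hG s hs)]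
        exact (hX s hs.1).mono (hsub t), fun s hs i => ((hG s hs).1 i).trans hr1⟩ hX0
      exact ⟨fun i => (abs_le_of_forall_Ico ((hζc i).mono (hsub T)) ht ht0
          fun s hs => (hb s hs).1 i).trans_lt hrr,
        fun i k => (abs_le_of_forall_Ico ((hXic i k).mono (hsub T)) ht ht0
          fun s hs => (hb s hs).2 i k).trans_lt hBB⟩
  refine ⟨X, hX0, fun t ht => ?_⟩
  rw [← hfield t (hin (t + 1) t ⟨ht, lt_add_one t⟩)]
  exact hX t ht

/-- Two arcs with the same initial state coincide on their common domain. -/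
theorem Arc.eqOn_of_initial_eq (hF : F.IsAdmissible) {s s' : F.Arc} (hT : s.T ≤ s'.T)
    (h0 : s.X 0 = s'.X 0) : EqOn s.X s'.X (Ico 0 s.T) := by
  intro t ht
  obtain ⟨r, B, hr0, hr1, -, -, harc⟩ := exists_arc_bound hF
    (s.zeta_lt 0 ⟨le_rfl, ht.1.trans_lt ht.2⟩)
  -- The bounds hold for every arc from this initial state, so both arcs solve one and the same
  -- globally Lipschitz saturated equation.
  obtain ⟨L, hL⟩ := saturatedField_lipschitz hF hr0 hr1 B
  have hcont : ∀ s : F.Arc, t < s.T → ContinuousOn s.X (Icc 0 t) := fun s hs =>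
    s.continuousOn.mono fun a ha => ⟨ha.1, ha.2.trans_lt hs⟩
  have hder : ∀ u : F.Arc, u.X 0 = s.X 0 → t < u.T → ∀ a ∈ Ico 0 t,
      HasDerivWithinAt u.X (F.saturatedField r B a (u.X a)) (Ici a) a := fun u hu hs a ha => by
    have haT : a ∈ Ico 0 u.T := ⟨ha.1, ha.2.trans hs⟩
    rw [saturatedField_eq (harc u hu a haT).1 (harc u hu a haT).2]
    exact hasDerivWithinAt_Ici_of_Ico haT (u.hasDerivWithinAt a haT)
  have hlt' := ht.2.trans_le hT
  exact ODE_solution_unique_of_mem_Icc_right (s := fun _ => univ)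
    (fun a ha => (hL a ha.1).lipschitzOnWith) (hcont s ht.2) (hder s rfl ht.2)
    (fun _ _ => trivial) (hcont s' hlt') (hder s' h0.symm hlt') (fun _ _ => trivial) h0
    (right_mem_Icc.2 ht.1)

/-! ### Passage between the filter equations and the first-order system -/

/-- Solutions of the filter equations are solutions of the first-order system. -/
theorem IsSolution.hasDerivWithinAt_state {D : Set ℝ} {y : Fin N → ℝ → ℝ}
    (hy : F.IsSolution D y) (hD : UniqueDiffOn ℝ D) {t : ℝ} (ht : t ∈ D) :
    HasDerivWithinAt (F.state D y) (F.vectorField t (F.state D y t)) D t := by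
  refine hasDerivWithinAt_pi.2 fun i => hasDerivWithinAt_pi.2 fun k => ?_
  have hk := k.2
  simp only [vectorField]
  split_ifs with h
  · have hlt : (((k : ℕ) : ℕ) : WithTop ℕ∞) < ((n - 1 : ℕ) : WithTop ℕ∞) := by
      exact_mod_cast (by omega : (k : ℕ) < n - 1)
    have hd := ((hy i).1.differentiableOn_iteratedDerivWithin hlt hD) t ht
    simp only [state]
    rw [iteratedDerivWithin_succ]
    exact hd.hasDerivWithinAt
  · have hkn : (k : ℕ) = n - 1 := by omega
    have := (hy i).2 t ht
    simpa only [state, hkn] using this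

/-- The state of the trajectories obtained from a solution of the first-order system. -/
theorem iteratedDerivWithin_of_solution (hn : 1 ≤ n) {D : Set ℝ} (hD : UniqueDiffOn ℝ D)
    {X : ℝ → Fin N → Fin n → ℝ}
    (hX : ∀ t ∈ D, HasDerivWithinAt X (F.vectorField t (X t)) D t) (i : Fin N) {k : ℕ}
    (hk : k < n) : EqOn (iteratedDerivWithin k (fun t => X t i ⟨0, hn⟩) D)
      (fun t => X t i ⟨k, hk⟩) D := by
  induction k with
  | zero => intro t _; simp
  | succ k ih =>
    intro t ht
    have ih' := ih (by omega)
    have hd := hasDerivWithinAt_pi.1 (hasDerivWithinAt_pi.1 (hX t ht) i) ⟨k, by omega⟩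
    rw [iteratedDerivWithin_succ, derivWithin_congr ih' (ih' ht), hd.derivWithin (hD t ht),
      vectorField, dif_pos hk]

/-- Solutions of the first-order system give solutions of the filter equations. -/
theorem isSolution_of_solution (hn : 1 ≤ n) {D : Set ℝ} (hD : UniqueDiffOn ℝ D)
    {X : ℝ → Fin N → Fin n → ℝ}
    (hX : ∀ t ∈ D, HasDerivWithinAt X (F.vectorField t (X t)) D t) :
    F.IsSolution D (fun i t => X t i ⟨0, hn⟩) ∧
      ∀ t ∈ D, F.state D (fun i t => X t i ⟨0, hn⟩) t = X t := by
  have hstate : ∀ t ∈ D, F.state D (fun i t => X t i ⟨0, hn⟩) t = X t := fun t ht =>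
    funext fun i => funext fun k => iteratedDerivWithin_of_solution hn hD hX i k.2 ht
  have hderiv : ∀ i, ∀ k (hk : k < n), ∀ t ∈ D,
      HasDerivWithinAt (iteratedDerivWithin k (fun t => X t i ⟨0, hn⟩) D)
        (F.vectorField t (X t) i ⟨k, hk⟩) D t := fun i k hk t ht =>
    (hasDerivWithinAt_pi.1 (hasDerivWithinAt_pi.1 (hX t ht) i) ⟨k, hk⟩).congr
      (iteratedDerivWithin_of_solution hn hD hX i hk)
      (iteratedDerivWithin_of_solution hn hD hX i hk ht)
  refine ⟨fun i => ⟨?_, fun t ht => ?_⟩, hstate⟩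
  · refine contDiffOn_of_differentiableOn_deriv (n := ((n - 1 : ℕ) : ℕ∞)) fun m hm t ht => ?_
    have hm' : m ≤ n - 1 := by exact_mod_cast hm
    exact (hderiv i m (by omega) t ht).differentiableWithinAt
  · have h := hderiv i (n - 1) (by omega) t ht
    rw [vectorField, dif_neg (by simp only; omega)] at h
    rwa [hstate t ht]

end FilterNetwork

end

theorem theorem1 {N n : ℕ} (hn : 1 ≤ n) (F : FilterNetwork N n)
    (ha : ∀ i j, 0 ≤ F.a i j) (hdiag : ∀ i, F.a i i = 0)
    (hb : ∀ i, F.b i = 0 ∨ F.b i = 1)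
    (hlam : 0 < F.lam) (hc : ∀ i, 0 < F.c i)
    (hrho : ∀ i, IsPerformanceFunction n (F.rho i))
    (hy0 : HasBoundedPiecewiseDerivs n F.y0)
    (htree : F.HasLeaderRootedSpanningTree) :
    -- a unique solution, defined for all times, which stays within the performance bounds
    (∀ x0 : Fin N → Fin n → ℝ, (∀ i, |F.zeta 0 x0 i| < 1) →
      ∃ y : Fin N → ℝ → ℝ, F.IsSolution (Set.Ici 0) y ∧ F.state (Set.Ici 0) y 0 = x0 ∧
        (∀ i t, 0 ≤ t → |F.zbar t (F.state (Set.Ici 0) y t) i| < F.rho i t) ∧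
        (∀ (T : ℝ) (w : Fin N → ℝ → ℝ), 0 < T → F.IsSolution (Set.Ico 0 T) w →
          F.state (Set.Ico 0 T) w 0 = x0 → ∀ i, Set.EqOn (w i) (y i) (Set.Ico 0 T))) ∧
    -- semi-global uniform boundedness and uniform ultimate boundedness of all signals
    (∃ μ : ℝ, ∀ ϱ : ℝ, 0 < ϱ → ϱ < 1 → ∀ R : ℝ, ∃ K τ : ℝ,
      ∀ y : Fin N → ℝ → ℝ, F.IsSolution (Set.Ici 0) y →
        (∀ i k, |F.state (Set.Ici 0) y 0 i k| ≤ R) →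
        (∀ i, |F.zeta 0 (F.state (Set.Ici 0) y 0) i| < 1 - ϱ) →
        (∀ t, 0 ≤ t → F.SignalsBoundedBy K t (F.state (Set.Ici 0) y t)) ∧
        (∀ t, 0 ≤ t → τ ≤ t → F.SignalsBoundedBy μ t (F.state (Set.Ici 0) y t))) := by
  have hF : F.IsAdmissible := ⟨hn, ha, hb, hlam, hc, hrho, hy0, htree⟩
  have hsub : ∀ T : ℝ, Ico 0 T ⊆ Ici 0 := fun T t ht => ht.1
  have hIci := uniqueDiffOn_Ici (0 : ℝ)
  constructor
  · intro x0 hx0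
    obtain ⟨X, hX0, hX⟩ := FilterNetwork.exists_global_solution hF hx0
    have hXT : ∀ T : ℝ, ∀ t ∈ Ico 0 T,
        HasDerivWithinAt X (F.vectorField t (X t)) (Ico 0 T) t := fun T t ht =>
      (hX t ht.1).mono (hsub T)
    have hζ : ∀ T : ℝ, ∀ t ∈ Ico 0 T, ∀ i, |F.zeta t (X t) i| < 1 := fun T =>
      FilterNetwork.abs_zeta_lt_one_of_solution hF (hXT T) (by rwa [hX0])
    obtain ⟨hsol, hstate⟩ := FilterNetwork.isSolution_of_solution (F := F) hn hIci hX
    refine ⟨_, hsol, (hstate 0 (mem_Ici.2 le_rfl)).trans hX0, fun i t ht => ?_,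
      fun T w hT hw hw0 i t ht => ?_⟩
    · rw [hstate t ht]
      have h := hζ (t + 1) t ⟨ht, lt_add_one t⟩ i
      rwa [FilterNetwork.zeta, abs_div, abs_of_pos (hF.rho_pos i ht),
        div_lt_one (hF.rho_pos i ht)] at h
    · have hwX := fun t (ht : t ∈ Ico 0 T) =>
        hw.hasDerivWithinAt_state (uniqueDiffOn_Ico 0 T) ht
      -- The competitor `w` is not assumed to respect the performance bounds; invariance forces it
      -- to.
      have hwζ := FilterNetwork.abs_zeta_lt_one_of_solution hF hwX (by rwa [hw0])
      have h := FilterNetwork.Arc.eqOn_of_initial_eq hF (s := ⟨T, _, hwX, hwζ⟩)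
        (s' := ⟨T, X, hXT T, hζ T⟩) le_rfl (hw0.trans hX0.symm) ht
      have h' := congrFun (congrFun h i) ⟨0, hn⟩
      simpa [FilterNetwork.state] using h'
  · obtain ⟨μ, hμ⟩ := FilterNetwork.Arc.exists_signals_bound hF
    refine ⟨μ, fun ϱ hϱ _ R => ?_⟩
    obtain ⟨K, τ, hK⟩ := hμ (ϱ, R)
    refine ⟨K, τ, fun y hy hR hζ => ?_⟩
    have hX : ∀ T : ℝ, ∀ t ∈ Ico 0 T, HasDerivWithinAt (F.state (Ici 0) y)
        (F.vectorField t (F.state (Ici 0) y t)) (Ico 0 T) t := fun T t ht =>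
      (hy.hasDerivWithinAt_state hIci ht.1).mono (hsub T)
    have hlt := fun T => FilterNetwork.abs_zeta_lt_one_of_solution hF (hX T)
      fun i => (hζ i).trans (by linarith)
    -- The global solution is cut to `[0, t + 1)` to become an arc. The constants do not depend on
    -- the length, so they hold for all times.
    have hb := fun t (ht : 0 ≤ t) => hK ⟨t + 1, _, hX (t + 1), hlt (t + 1)⟩
      ⟨hϱ, by simp only; linarith, hR, fun i => (hζ i).le⟩ t ⟨ht, lt_add_one t⟩
    exact ⟨fun t ht => (hb t ht).1, fun t ht hτ => (hb t ht).2 hτ⟩
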